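/- Let $\nu$ be a probability measure on $\mathbb Z$ which is centered ($\sum_k |k|\,\nu(k)<\infty$ and $\sum_k k\,\nu(k)=0$), upwards-skip-free ($\nu(k)=0$ for all $k\ge 2$) and such that $\nu(0)=0$. Define probability measures on $\mathbb Z_+$ by $$\nu_\circ(k)=\nu(1)(1-\nu(1))^k,\qquad \nu_\bullet(k)=\frac{\nu(-k)}{1-\nu(1)},\qquad k\in\mathbb Z_+ .$$ Let $C=(C_k)_{k\ge 0}$ be a random walk started at $0$ with step distribution $\nu$. *The looptree $\mathbf L_C$.* Extend $C$ to $\mathbb Z$ by $C_k=k$ for $k\le 0$, and for $i,j\in\mathbb Z$ let $i\sim j$ if $C_i=C_j=\min\{C_k: i\wedge j\le k\le i\vee j\}$. Draw the graph of $-C$ (with linear interpolation) in the plane, add the horizontal edges between the points $(i,-C_i)$ and $(j,-C_j)$ for all $i\sim j$, and contract these horizontal edges. The resulting infinite planar map, with vertex set $\mathbb Z/{\sim}$, is the infinite looptree $\mathbf L_C$ (well defined, with finite classes and finite internal faces, almost surely). Its root edge goes from $0$ to $1$; its root face is the (infinite) face on the right of the root edge, i.e. the one below the graph, and its other faces are called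 internal. *The tree of components $\mathbf T_C=\mathrm{Tree}(\mathbf L_C)$.* Its white vertices are the vertices of $\mathbf L_C$, its black vertices are the internal faces of $\mathbf L_C$, and each internal face is joined to all the vertices incident to it. This tree is a locally finite plane tree whose root is the class of $0$. The children of a vertex are ordered from left to right, that is, clockwise around this vertex in the embedding, starting from its parent; the children of the root are ordered clockwise starting from the corner of the root face which lies immediately on the right of the root edge (so that the face on the left of the root edge is the last child of the root). *The law $\mathsf{GW}^{(\infty,l)}_{\nu_\circ,\nu_\bullet}$.* For a probability measure $p$ on $\mathbb Z_+$ with mean $m\in(0,\infty)$ put $\bar p(k)=k\,p(k)/m$. Let $\mathbf T_\infty$ be the random plane tree with a distinguished infinite spine started at the root such that the vertices of the spine at even (white) and odd (black) height have offspring distribution $\bar\nu_\circ$ and $\bar\nu_\bullet$ respectively, the child of each vertex of the spine that belongs to the spine is uniform among its children, vertices out of the spine at even and odd height have offspring distribution $\nu_\circ$ and $\nu_\bullet$ respectively, and all these choices are independent. Then $\mathsf{GW}^{(\infty,l)}_{\nu_\circ,\nu_\bullet}$ is the law of the plane tree obtained from $\mathbf T_\infty$ by discarding all the vertices on the left of the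 spine, except the children of black vertices of the spine. **Proposition.** The tree of components $\mathbf T_C$ of $\mathbf L_C$ has law $\mathsf{GW}^{(\infty,l)}_{\nu_\circ,\nu_\bullet}$, as a random element of the set of locally finite plane trees with the Borel $\sigma$-algebra of the local topology. -/

import Mathlib

open MeasureTheory ProbabilityTheory
open scoped ENNReal

/-! ## Locally finite plane trees -/

/-- A locally finite plane tree in Neveu's formalism: a set of finite words which contains the empty
word (the root), is closed under taking parents, and in which the children of a vertex `v` are
`v ++ [0], …, v ++ [k - 1]` for some finite `k` (children are numbered from `0`, from left to
right). Vertices of even height are white, vertices of odd height are black. -/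
@[ext]
structure PlaneTree where
  verts : Set (List ℕ)
  nil_mem : [] ∈ verts
  parent_mem : ∀ (v : List ℕ) (j : ℕ), v ++ [j] ∈ verts → v ∈ verts
  locallyFinite : ∀ v ∈ verts, ∃ k : ℕ, ∀ j : ℕ, v ++ [j] ∈ verts ↔ j < k

namespace PlaneTree

/-- The number `k_v(t)` of children of `v` in `t`. -/
noncomputable def numChildren (t : PlaneTree) (v : List ℕ) : ℕ :=
  {j : ℕ | v ++ [j] ∈ t.verts}.ncard

/-- The ball of radius `R` of `t` around its root. -/
def ball (t : PlaneTree) (R : ℕ) : Set (List ℕ) := {v ∈ t.verts | v.length ≤ R}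

/-- The σ-algebra generated by the balls `{t | B_R(t) = B_R(s)}` of the local distance. As there are
only countably many finite plane trees, this is the Borel σ-algebra of the local topology. -/
instance : MeasurableSpace PlaneTree :=
  MeasurableSpace.generateFrom {A | ∃ (s : PlaneTree) (R : ℕ), A = {t | t.ball R = s.ball R}}

/-- The plane tree generated by a root individual `root : S` when every individual `s : S` has the
finite ordered list of children `kids s`. The word `[j₁, …, jₙ]` is a vertex if one can go from
`root` to its `j₁`-th child, then to the `j₂`-th child of the latter, and so on. -/
def unfold {S : Type*} (kids : S → List S) (root : S) : PlaneTree where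
  verts := {w | (w.foldlM (fun s j => (kids s)[j]?) root).isSome}
  nil_mem := by simp
  parent_mem := by
    intro v j h
    simp only [Set.mem_ofPred_eq, List.foldlM_append] at h ⊢
    cases hv : v.foldlM (fun s j => (kids s)[j]?) root with
    | none => simp [hv] at h
    | some s => rfl
  locallyFinite := by
    intro v h
    simp only [Set.mem_ofPred_eq] at h
    obtain ⟨s, hs⟩ := Option.isSome_iff_exists.1 h
    refine ⟨(kids s).length, fun j => ?_⟩
    simp [List.foldlM_append, hs]

end PlaneTree

/-! ## Rooted maps and their tree of components -/

/-- A rooted, possibly infinite, connected map on an oriented surface, up to orientation-preserving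
homeomorphism, given by its rotation system: `Dart` is the set of oriented edges, `σ` sends a dart
to the next dart with the same origin in counterclockwise order, `α` reverses a dart, and `root` is
the root edge. The vertices are the orbits of `σ`, and the faces are the orbits of `φ` below. -/
structure RootedMap where
  Dart : Type
  σ : Equiv.Perm Dart
  α : Equiv.Perm Dart
  α_invol : ∀ d, α (α d) = d
  α_ne : ∀ d, α d ≠ d
  connected : ∀ d e, ∃ g ∈ Subgroup.closure {σ, α}, g d = e
  root : Dart

namespace RootedMap

variable (M : RootedMap)

/-- The face permutation: `M.φ d` is the dart that follows `d` when one walks along the face which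
lies on the left of `d`. -/
def φ : Equiv.Perm M.Dart := M.σ⁻¹ * M.α

/-- The face on the left of `d` is internal, i.e. is not the root face (the root face is the face on
the right of the root edge). The angular sector at the origin of `d` between `d` and `M.σ d` is the
corner attached to `d`; it is a corner of the face on the left of `d`. -/
def IsInternal (d : M.Dart) : Prop := ¬ M.φ.SameCycle (M.α M.root) d

/-- The elements `f d, f² d, …, fⁿ d` (in this order). -/
def iterates {D : Type} (f : Equiv.Perm D) (d : D) (n : ℕ) : List D :=
  (List.range n).map fun k => (f ^ (k + 1)) d

/-- The vertices of the tree of components. A vertex other than the root is designated by the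
internal corner, attached to the dart `d`, which is crossed by the tree edge between this vertex and
its parent: `white d` is the origin of `d` and `black d` is the face on the left of `d`. -/
inductive Component
  | origin : Component
  | white (d : M.Dart) : Component
  | black (d : M.Dart) : Component

open Classical in
/-- The children of a vertex of the tree of components, from left to right, i.e. in clockwise order
around this vertex, starting from its parent (or, for the origin of the map, from the corner of the
root face which lies on the right of the root edge).
* The children of the origin correspond to all the internal corners around the origin.
* The children of a black vertex, that is of an internal face, correspond to the corners of this
  face, except that at the parent vertex.
* The children of a white vertex, that is of a vertex of the map, correspond to the internal corners
  around this vertex, except that in the parent face. -/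
noncomputable def componentKids : M.Component → List M.Component
  | .origin =>
      ((iterates M.σ⁻¹ M.root (Function.minimalPeriod M.σ M.root)).filter
        fun d => decide (M.IsInternal d)).map .black
  | .black d => (iterates M.φ⁻¹ d (Function.minimalPeriod M.φ d - 1)).map .white
  | .white d =>
      ((iterates M.σ⁻¹ d (Function.minimalPeriod M.σ d - 1)).filter
        fun e => decide (M.IsInternal e)).map .black

/-- The tree of components `Tree(M)` of a looptree `M` with finite internal faces and finite vertex
degrees: a vertex is added inside each internal face and is joined to the vertices of this face, and
the edges of `M` are erased. (The incidence graph of vertices and internal faces of a looptree is a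
tree, so that it is its own unfolding from the origin.) -/
noncomputable def tree : PlaneTree := PlaneTree.unfold M.componentKids .origin

end RootedMap

/-! ## The infinite looptree coded by a function -/

namespace Coding

variable (C : ℕ → ℤ)

/-- The function `C` extended to `ℤ` by `C_k = k` for `k ≤ 0` (recall that `C 0 = 0`). -/
def extend (k : ℤ) : ℤ := if 0 ≤ k then C k.toNat else k

/-- `i ∼ j` iff `C_i = C_j = inf {C_k : i ∧ j ≤ k ≤ i ∨ j}`. -/
def Equivalent (i j : ℤ) : Prop :=
  extend C i = extend C j ∧ ∀ k, min i j ≤ k → k ≤ max i j → extend C i ≤ extend C k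

theorem Equivalent.symm {C : ℕ → ℤ} {i j : ℤ} (h : Equivalent C i j) : Equivalent C j i :=
  ⟨h.1.symm, fun k h1 h2 => h.1 ▸ h.2 k (by rwa [min_comm]) (by rwa [max_comm])⟩

theorem Equivalent.trans {C : ℕ → ℤ} {i j k : ℤ} (h : Equivalent C i j)
    (h' : Equivalent C j k) : Equivalent C i k := by
  refine ⟨h.1.trans h'.1, fun l h1 h2 => ?_⟩
  by_cases hl : min i j ≤ l ∧ l ≤ max i j
  · exact h.2 l hl.1 hl.2
  · rw [h.1]
    exact h'.2 l (by omega) (by omega)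

open Classical in
/-- The equivalence class of `i`, listed in increasing order (if it is finite). -/
noncomputable def classList (i : ℤ) : List ℤ :=
  if h : {j : ℤ | Equivalent C j i}.Finite then h.toFinset.sort else []

theorem classList_congr {C : ℕ → ℤ} {i j : ℤ} (h : Equivalent C i j) :
    classList C i = classList C j := by
  have : {k : ℤ | Equivalent C k i} = {k : ℤ | Equivalent C k j} :=
    Set.ext fun k => ⟨fun hk => hk.trans h, fun hk => hk.trans h.symm⟩
  unfold classList
  split_ifs with h1 h2 h2
  · congr 1
    ext k
    simp only [Set.Finite.mem_toFinset, this]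
  · exact absurd (this ▸ h1) h2
  · exact absurd (this ▸ h2) h1
  · rfl

theorem equivalent_of_mem {C : ℕ → ℤ} {i j : ℤ} (h : j ∈ classList C i) : Equivalent C j i := by
  unfold classList at h
  split_ifs at h with hf
  · simpa using h
  · simp at h

theorem classList_formPerm_apply (i : ℤ) :
    classList C ((classList C i).formPerm i) = classList C i := by
  by_cases h : (classList C i).formPerm i = i
  · rw [h]
  · have hi := List.mem_of_formPerm_apply_ne h
    exact classList_congr (equivalent_of_mem (List.formPerm_apply_mem_of_mem hi))

theorem classList_formPerm_inv_apply (i : ℤ) :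
    classList C ((classList C i).formPerm⁻¹ i) = classList C i := by
  by_cases h : (classList C i).formPerm⁻¹ i = i
  · rw [h]
  · have h' : (classList C i).formPerm ((classList C i).formPerm⁻¹ i) ≠
        (classList C i).formPerm⁻¹ i := by
      simpa using fun h' => h h'.symm
    exact classList_congr (equivalent_of_mem (List.mem_of_formPerm_apply_ne h'))

/-- The permutation of `ℤ` which sends `i` to the next element of its equivalence class, and the
largest element of a class to the smallest one. -/
noncomputable def next : Equiv.Perm ℤ where
  toFun i := (classList C i).formPerm i
  invFun i := (classList C i).formPerm⁻¹ i
  left_inv i := by simp only [classList_formPerm_apply]; simp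
  right_inv i := by simp only [classList_formPerm_inv_apply]; simp

/-- The oriented edges of the graph of `-C`: `right i` is the edge from `i` to `i + 1`, and `left i`
is the edge from `i` to `i - 1`. -/
inductive Step
  | left (i : ℤ) : Step
  | right (i : ℤ) : Step

/-- The infinite looptree `L_C`, which is obtained from the graph of `-C`, drawn in the plane with
linear interpolation, by contracting the horizontal edges between equivalent integers (these lie
above the graph). When the class `i₁ < ⋯ < iₚ` is contracted, the counterclockwise order of the
oriented edges around the resulting vertex is `left i₁, right i₁, …, left iₚ, right iₚ`. The root
edge goes from `0` to `1`, so that the root face is the face below the graph. -/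
noncomputable def looptree : RootedMap where
  Dart := Step
  σ :=
    { toFun := fun d => match d with
        | .left i => .right i
        | .right i => .left (next C i)
      invFun := fun d => match d with
        | .left i => .right ((next C).symm i)
        | .right i => .left i
      left_inv := by rintro (i | i) <;> simp
      right_inv := by rintro (i | i) <;> simp }
  α :=
    { toFun := fun d => match d with
        | .left i => .right (i - 1)
        | .right i => .left (i + 1)
      invFun := fun d => match d with
        | .left i => .right (i - 1)
        | .right i => .left (i + 1)
      left_inv := by rintro (i | i) <;> simp
      right_inv := by rintro (i | i) <;> simp }
  α_invol := by rintro (i | i) <;> simp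
  α_ne := by rintro (i | i) <;> simp
  connected := by
    set s : Equiv.Perm Step := _
    set a : Equiv.Perm Step := _
    change ∀ d e : Step, ∃ g ∈ Subgroup.closure {s, a}, g d = e
    have hs : s ∈ Subgroup.closure {s, a} := Subgroup.subset_closure (by simp)
    have ha : a ∈ Subgroup.closure {s, a} := Subgroup.subset_closure (by simp)
    have h1 : ∀ i, (s * a) (Step.right i) = Step.right (i + 1) := fun i => rfl
    have h2 : ∀ n : ℕ, ∀ i, ((s * a) ^ n) (Step.right i) = Step.right (i + n) := by
      intro n
      induction n with
      | zero => intro i; simp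
      | succ n ih => intro i; rw [pow_succ, Equiv.Perm.mul_apply, h1, ih]; congr 1; push_cast; ring
    have key : ∀ d : Step, ∃ g ∈ Subgroup.closure {s, a}, g (Step.right 0) = d := by
      have hr : ∀ i, ∃ g ∈ Subgroup.closure {s, a}, g (Step.right 0) = Step.right i := by
        intro i
        rcases Int.le_total 0 i with hi | hi
        · refine ⟨(s * a) ^ i.toNat, pow_mem (mul_mem hs ha) _, ?_⟩
          rw [h2]; congr 1; omega
        · refine ⟨((s * a) ^ (-i).toNat)⁻¹, inv_mem (pow_mem (mul_mem hs ha) _), ?_⟩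
          rw [Equiv.Perm.inv_eq_iff_eq, h2]; congr 1; omega
      rintro (i | i)
      · obtain ⟨g, hg, hgi⟩ := hr i
        refine ⟨s⁻¹ * g, mul_mem (inv_mem hs) hg, ?_⟩
        rw [Equiv.Perm.mul_apply, hgi]
        rfl
      · exact hr i
    intro d e
    obtain ⟨g, hg, hgd⟩ := key d
    obtain ⟨g', hg', hge⟩ := key e
    refine ⟨g' * g⁻¹, mul_mem hg' (inv_mem hg), ?_⟩
    rw [Equiv.Perm.mul_apply, Equiv.Perm.inv_eq_iff_eq.2 hgd.symm, hge]
  root := .right 0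

/-- The tree of components `T_C = Tree(L_C)`. -/
noncomputable def componentTree : PlaneTree := (looptree C).tree

end Coding

/-! ## Kesten's two-type tree -/

/-- The size-biased distribution `k ↦ k p(k) / m` of a probability measure `p` on `ℤ₊` with mean
`m ∈ (0, ∞)` (and an irrelevant value if the mean is `0` or `∞`). -/
noncomputable def sizeBiased (p : PMF ℕ) : PMF ℕ :=
  open Classical in
  if h : (∑' k : ℕ, (k : ℝ≥0∞) * p k) ≠ 0 ∧ (∑' k : ℕ, (k : ℝ≥0∞) * p k) ≠ ∞ then
    PMF.normalize (fun k : ℕ => (k : ℝ≥0∞) * p k) h.1 h.2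
  else p

/-- The law of `(X, U)` where `X` is a random variable with the size-biased distribution of `p` and,
given `X`, `U` is uniform on `{0, …, X - 1}`. -/
noncomputable def spineLaw (p : PMF ℕ) : PMF (ℕ × ℕ) :=
  (sizeBiased p).bind fun k => match k with
    | 0 => PMF.pure (0, 0)
    | m + 1 => (PMF.uniformOfFintype (Fin (m + 1))).map fun u => (m + 1, (u : ℕ))

namespace Kesten

/-- The offspring distribution at height `n`: `p` (white) if `n` is even, `q` (black) if `n` is
odd. -/
def offspring (p q : PMF ℕ) (n : ℕ) : PMF ℕ := if Even n then p else q

/-- The randomness used to build the tree: the `n`-th vertex of the spine has `(ξ n).1` children, of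
which the one of rank `(ξ n).2` is in the spine; a vertex `w` out of the spine has `η w` children. -/
abbrev Sample : Type := (ℕ → ℕ × ℕ) × (List ℕ → ℕ)

noncomputable def sampleLaw (p q : PMF ℕ) : Measure Sample :=
  (Measure.infinitePi fun n : ℕ => (spineLaw (offspring p q n)).toMeasure).prod
    (Measure.infinitePi fun w : List ℕ => (offspring p q w.length).toMeasure)

/-- The `n`-th vertex of the spine. -/
def spine (x : Sample) (n : ℕ) : List ℕ := (List.range n).map fun i => (x.1 i).2

/-- The number of children of the vertex `w`. -/
def degree (x : Sample) (w : List ℕ) : ℕ :=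
  if w = spine x w.length then (x.1 w.length).1 else x.2 w

/-- Kesten's two-type tree `T_∞`. -/
def tree (x : Sample) : PlaneTree :=
  PlaneTree.unfold (fun w : List ℕ => (List.range (degree x w)).map fun j => w ++ [j]) []

end Kesten

namespace PlaneTree

/-- The vertex `w` is discarded by the pruning on the left of the spine `s`: it descends from a
child `s n ++ [j]` of a spine vertex which is on the left of `s (n + 1)`, and it is not a child of a
black vertex of the spine. -/
def DiscardedLeft (s : ℕ → List ℕ) (w : List ℕ) : Prop :=
  ∃ (n j u : ℕ) (r : List ℕ), w = s n ++ j :: r ∧ s (n + 1) = s n ++ [u] ∧ j < u ∧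
    ¬ (Odd n ∧ r = [])

open Classical in
/-- The plane tree obtained from `t` by discarding all the vertices on the left of the spine `s`,
excluding the children of the black vertices of the spine. The remaining vertices keep their order
(and are renumbered accordingly). -/
noncomputable def pruneLeft (t : PlaneTree) (s : ℕ → List ℕ) : PlaneTree :=
  unfold (fun w : List ℕ =>
    ((List.range (t.numChildren w)).map fun j => w ++ [j]).filter
      fun v => decide (¬ DiscardedLeft s v)) []

end PlaneTree

/-- The law `GW^{(∞,l)}_{p,q}` of Kesten's two-type tree with offspring distributions `p` (white)
and `q` (black), pruned on the left of its spine. -/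
noncomputable def kestenLeftLaw (p q : PMF ℕ) : Measure PlaneTree :=
  (Kesten.sampleLaw p q).map fun x => (Kesten.tree x).pruneLeft (Kesten.spine x)

/-! ## The random walk -/

/-- `ν` is centered and upwards-skip-free, and does not charge `0`. -/
structure IsStepLaw (ν : Measure ℤ) : Prop where
  integrable : Integrable (fun k : ℤ => (k : ℝ)) ν
  centered : ∫ k : ℤ, (k : ℝ) ∂ν = 0
  skipFree : ν (Set.Ioi 1) = 0
  zero : ν {0} = 0

/-- The law `P^ν_0` of the random walk started at `0` with step distribution `ν`. -/
noncomputable def walkLaw (ν : Measure ℤ) : Measure (ℕ → ℤ) :=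
  (Measure.infinitePi fun _ : ℕ => ν).map fun x n => ∑ i ∈ Finset.range n, x i

namespace IsStepLaw

variable {ν : Measure ℤ} [IsProbabilityMeasure ν]

theorem one_ne_zero (h : IsStepLaw ν) : ν {1} ≠ 0 := by
  intro h1
  have hae : ∀ᵐ k : ℤ ∂ν, (k : ℝ) ≤ -1 := by
    rw [ae_iff]
    refine measure_mono_null (t := Set.Ioi 1 ∪ ({0} ∪ {1})) ?_
      (measure_union_null h.skipFree (measure_union_null h.zero h1))
    intro k hk
    simp only [Set.mem_ofPred_eq, not_le] at hk
    have : (-1 : ℤ) < k := by exact_mod_cast hk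
    simp only [Set.mem_union, Set.mem_Ioi, Set.mem_singleton_iff]
    omega
  have := integral_mono_ae h.integrable (integrable_const (-1 : ℝ)) hae
  rw [h.centered] at this
  simp at this
  linarith

theorem one_ne_one (h : IsStepLaw ν) : ν {1} ≠ 1 := by
  intro h1
  have hae : (fun k : ℤ => (k : ℝ)) =ᵐ[ν] fun _ => 1 := by
    have h2 : ∀ᵐ k : ℤ ∂ν, k ∈ ({1} : Set ℤ) :=
      (mem_ae_iff_prob_eq_one (MeasurableSet.singleton 1)).2 h1
    filter_upwards [h2] with k hk
    simp only [Set.mem_singleton_iff] at hk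
    simp [hk]
  have := integral_congr_ae hae
  rw [h.centered] at this
  simp at this

/-- The offspring distribution `ν_∘(k) = ν(1) (1 - ν(1))^k`. -/
noncomputable def white (h : IsStepLaw ν) : PMF ℕ :=
  ⟨fun k => ν {1} * (1 - ν {1}) ^ k, by
    rw [ENNReal.summable.hasSum_iff, ENNReal.tsum_mul_left, ENNReal.tsum_geometric,
      ENNReal.sub_sub_cancel ENNReal.one_ne_top prob_le_one]
    exact ENNReal.mul_inv_cancel h.one_ne_zero (measure_ne_top ν _)⟩

/-- The offspring distribution `ν_•(k) = ν(-k) / (1 - ν(1))`. -/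
noncomputable def black (h : IsStepLaw ν) : PMF ℕ :=
  ⟨fun k => ν {-(k : ℤ)} / (1 - ν {1}), by
    have hsum : ∑' k : ℕ, ν {-(k : ℤ)} = 1 - ν {1} := by
      have hd : Pairwise (Function.onFun Disjoint fun k : ℕ => ({-(k : ℤ)} : Set ℤ)) := by
        intro i j hij
        simp only [Function.onFun, Set.disjoint_singleton]
        omega
      rw [← measure_iUnion hd fun k => MeasurableSet.singleton _,
        ← prob_compl_eq_one_sub (MeasurableSet.singleton 1)]
      refine le_antisymm (measure_mono ?_) ?_
      · intro k hk
        simp only [Set.mem_iUnion, Set.mem_singleton_iff] at hk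
        simp only [Set.mem_compl_iff, Set.mem_singleton_iff]
        omega
      · refine (measure_mono (t := (⋃ k : ℕ, ({-(k : ℤ)} : Set ℤ)) ∪ Set.Ioi 1) ?_).trans
          ((measure_union_le _ _).trans (by rw [h.skipFree, add_zero]))
        intro k hk
        simp only [Set.mem_compl_iff, Set.mem_singleton_iff] at hk
        by_cases hk' : 1 < k
        · exact Or.inr hk'
        · exact Or.inl (Set.mem_iUnion.2 ⟨(-k).toNat, by simp only [Set.mem_singleton_iff]; omega⟩)
    have h0 : 1 - ν {1} ≠ 0 := fun h0 =>
      h.one_ne_one (le_antisymm prob_le_one (tsub_eq_zero_iff_le.1 h0))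
    have ht : 1 - ν {1} ≠ ∞ := ne_top_of_le_ne_top ENNReal.one_ne_top tsub_le_self
    rw [ENNReal.summable.hasSum_iff]
    simp only [div_eq_mul_inv]
    rw [ENNReal.tsum_mul_right, hsum, ENNReal.mul_inv_cancel h0 ht]⟩

end IsStepLaw

-- The proof cuts the walk at its strict descending ladder times and matches each piece with two
-- generations of the spine. From a ladder time with value `V`, the walk stays at or above `V` until
-- its last visit to `V` before the next ladder time. This excursion codes the subtrees on the right
-- of a white spine vertex. The walk then climbs strictly above `V`, which codes subtrees grafted on
-- a black spine vertex, and jumps to `V - 1 - k`. The resulting face touches the integers `V - 1,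
-- …, V - 1 - k` of the negative half-line. The first `k` were jumped over: their classes are
-- singletons, and they are the bare children left of the spine. The last one is the next white
-- spine vertex. Clockwise order is decreasing time, so a forest is coded from its last tree to its
-- first. `kids_spine` and `matchL_of_reads` turn this coding into the children lists of the
-- looptree, so that `n` blocks determine the ball of radius `2 n` (`ball_componentTree`).
-- `exists_blocks` parses every path which keeps going below its present value, and almost every
-- path does so (`Walk.ae_isGood`). On the other side, the pruned Kesten tree displays a sequence of
-- blocks on an event `Matches`, whose probability is exactly that of the corresponding word
-- (`IsStepLaw.sampleLaw_matches`). Off the spine, the factors `1 - ν(1)` of the geometric law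
-- cancel the denominators of the black law. On the spine, size-biasing cancels against the uniform
-- choice, and summing over the discarded left children of a white vertex leaves the geometric law
-- again. Covering the walk event by words, and using that the events `Matches` are disjoint, gives
-- an inequality between the two laws for every property of a ball. Applied to the complementary
-- property, it gives equality. Hence Kesten's tree never has to be shown to be almost surely
-- parsable.

-- Finite plane forests and the individuals that generate them

/-- Finite plane trees: `nil` is a single vertex, and `cons h t` is obtained from `t` by grafting `h`
on a new first child of the root. -/
inductive CTree
  | nil : CTree
  | cons (h t : CTree) : CTree

namespace CTree

/-- The list of the subtrees at the children of the root. -/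
def kids : CTree → List CTree
  | nil => []
  | cons h t => h :: kids t

/-- The number of children of the root. -/
def len : CTree → ℕ
  | nil => 0
  | cons _ t => len t + 1

/-- The tree with a prescribed list of subtrees at the children of the root. -/
def ofList (l : List CTree) : CTree := l.foldr cons nil

@[simp] theorem kids_ofList (l : List CTree) : (ofList l).kids = l := by
  induction l with
  | nil => rfl
  | cons a l ih => simpa [ofList, kids] using ih

/-- The individuals of the list `l` generate the trees in `t.kids`, when `kd` gives the children. -/
def MatchL {S : Type*} (kd : S → List S) : List S → CTree → Prop
  | l, nil => l = []
  | l, cons h t => ∃ s l', l = s :: l' ∧ MatchL kd (kd s) h ∧ MatchL kd l' t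

theorem MatchL.length_eq {S : Type*} {kd : S → List S} {l : List S} {t : CTree}
    (h : MatchL kd l t) : l.length = t.len := by
  induction t generalizing l with
  | nil => simp_all [MatchL, len]
  | cons a t _ ih =>
    obtain ⟨s, l', rfl, _, h2⟩ := h
    simp [len, ih h2]

/-- Generation is deterministic. This is the source of the disjointness of the events `Matches` in
the final comparison. -/
theorem MatchL.unique {S : Type*} {kd : S → List S} {l : List S} {t t' : CTree}
    (h : MatchL kd l t) (h' : MatchL kd l t') : t = t' := by
  induction t generalizing l t' with
  | nil =>
    cases t' with
    | nil => rfl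
    | cons a t' => obtain ⟨s, l', rfl, _⟩ := h'; simp [MatchL] at h
  | cons a t ih1 ih2 =>
    obtain ⟨s, l', rfl, h1, h2⟩ := h
    cases t' with
    | nil => simp [MatchL] at h'
    | cons a' t' =>
      obtain ⟨s', l'', he, h1', h2'⟩ := h'
      obtain ⟨rfl, rfl⟩ := List.cons.inj he
      rw [ih1 h1 h1', ih2 h2 h2']

end CTree

namespace PlaneTree

/-- `s` and `s'` generate the same tree up to height `n`. -/
def Agree {S S' : Type*} (kd : S → List S) (kd' : S' → List S') : ℕ → S → S' → Prop
  | 0, _, _ => True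
  | n + 1, s, s' => List.Forall₂ (Agree kd kd' n) (kd s) (kd' s')

theorem agree_of_matchL {S : Type*} {kd : S → List S} {t : CTree} {l : List S}
    (h : CTree.MatchL kd l t) (n : ℕ) : List.Forall₂ (Agree kd CTree.kids n) l t.kids := by
  induction t generalizing l n with
  | nil => simp_all [CTree.MatchL, CTree.kids]
  | cons a t ih1 ih2 =>
    obtain ⟨s, l', rfl, h1, h2⟩ := h
    refine List.Forall₂.cons ?_ (ih2 h2 n)
    cases n with
    | zero => trivial
    | succ n => exact ih1 h1 n

theorem Agree.of_matchL {S : Type*} {kd : S → List S} {t : CTree} {s : S}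
    (h : CTree.MatchL kd (kd s) t) (n : ℕ) : Agree kd CTree.kids n s t := by
  cases n with
  | zero => trivial
  | succ n => exact agree_of_matchL h n

theorem Agree.mono {S S' : Type*} {kd : S → List S} {kd' : S' → List S'} {n m : ℕ} (hnm : n ≤ m)
    {s : S} {s' : S'} (h : Agree kd kd' m s s') : Agree kd kd' n s s' := by
  induction n generalizing m s s' with
  | zero => trivial
  | succ n ih =>
    obtain ⟨m, rfl⟩ : ∃ k, m = k + 1 := ⟨m - 1, by omega⟩
    exact List.Forall₂.imp (fun a b hab => ih (by omega) hab) h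

theorem Agree.isSome_iff {S S' : Type*} {kd : S → List S} {kd' : S' → List S'} {n : ℕ}
    {s : S} {s' : S'} (h : Agree kd kd' n s s') (w : List ℕ) (hw : w.length ≤ n) :
    (w.foldlM (fun s j => (kd s)[j]?) s).isSome ↔
      (w.foldlM (fun s j => (kd' s)[j]?) s').isSome := by
  induction w generalizing n s s' with
  | nil => simp
  | cons j w ih =>
    obtain ⟨n, rfl⟩ : ∃ k, n = k + 1 := ⟨n - 1, by simp at hw; omega⟩
    have hl := List.Forall₂.length_eq h
    simp only [List.foldlM_cons]
    by_cases hj : j < (kd s).length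
    · have hj' : j < (kd' s').length := hl ▸ hj
      rw [List.getElem?_eq_getElem hj, List.getElem?_eq_getElem hj']
      exact ih (List.Forall₂.get h hj hj') (by simpa using hw)
    · rw [List.getElem?_eq_none (by omega), List.getElem?_eq_none (by omega)]
      simp

theorem Agree.ball_eq {S S' : Type*} {kd : S → List S} {kd' : S' → List S'} {n : ℕ}
    {s : S} {s' : S'} (h : Agree kd kd' n s s') :
    (unfold kd s).ball n = (unfold kd' s').ball n := by
  ext w
  simp only [ball, unfold, Set.mem_ofPred_eq]
  constructor
  · exact fun ⟨h1, h2⟩ => ⟨(h.isSome_iff w h2).1 h1, h2⟩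
  · exact fun ⟨h1, h2⟩ => ⟨(h.isSome_iff w h2).2 h1, h2⟩

end PlaneTree

/-! ## Words -/

namespace CTree

mutual
/-- The steps of the walk above a white vertex. -/
def whiteWord : CTree → List ℤ
  | nil => []
  -- The first tree is read last, because children are listed clockwise, against time. The last step
  -- undoes the climb of `blackWord b` and closes the face.
  | cons b r => whiteWord r ++ (blackWord b ++ [-(b.len : ℤ)])
/-- The steps of the walk during an excursion coding a black vertex, except the last one. -/
def blackWord : CTree → List ℤ
  | nil => []
  | cons w r => blackWord r ++ 1 :: whiteWord w
end

end CTree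

/-- The part of the tree of components carried by a white vertex of the spine and its child in the
spine: the subtrees at the right of the spine above the white and black vertices, and the number `k`
minus one of children of the black vertex at the left of the spine. -/
structure Block where
  right : CTree
  k : ℕ
  above : CTree

namespace Block

/-- The steps of the walk which code a block. -/
def word (b : Block) : List ℤ :=
  b.right.whiteWord ++ (b.above.blackWord ++ [-(b.above.len + (b.k + 1) : ℤ)])

/-- The tree made of a finite sequence of blocks. -/
def toTree : List Block → CTree
  | [] => .nil
  -- The spine goes through the first child of the white vertex, since nothing remains on its left.
  -- The black child keeps `b.k` leaves on the left.
  | b :: d => .cons (.ofList (List.replicate b.k .nil ++ toTree d :: b.above.kids)) b.right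

end Block

-- Orbits of a permutation read off a chain

namespace RootedMap

/-- A closed chain of distinct elements along which `f` moves backwards is a whole orbit, so it
gives both the period and the enumeration by `f⁻¹`. It serves for vertices (`σ`) and for faces
(`φ`). -/
theorem iterates_inv_of_isChain {D : Type} (f : Equiv.Perm D) (d : D) (l : List D)
    (hc : List.IsChain (fun x y => f y = x) (d :: l))
    (hlast : f d = (d :: l).getLast (List.cons_ne_nil _ _)) (hnd : (d :: l).Nodup) :
    Function.minimalPeriod f d = l.length + 1 ∧ iterates f⁻¹ d l.length = l ∧
      iterates f⁻¹ d (l.length + 1) = l ++ [d] := by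
  have key : ∀ k (hk : k < (d :: l).length), (f⁻¹ ^ k) d = (d :: l)[k] := by
    intro k
    induction k with
    | zero => intro _; rfl
    | succ k ih =>
      intro hk
      rw [pow_succ', Equiv.Perm.mul_apply, ih (by omega), Equiv.Perm.inv_eq_iff_eq]
      exact (List.isChain_iff_getElem.1 hc k (by omega)).symm
  have hlen : (f⁻¹ ^ (l.length + 1)) d = d := by
    rw [pow_succ', Equiv.Perm.mul_apply, key _ (by simp), Equiv.Perm.inv_eq_iff_eq, hlast,
      List.getLast_eq_getElem]
    simp
  have hit : iterates f⁻¹ d l.length = l := by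
    refine List.ext_getElem (by simp [iterates]) fun k h1 h2 => ?_
    simp only [iterates, List.getElem_map, List.getElem_range]
    rw [key _ (by simpa using h2)]
    rfl
  refine ⟨?_, hit, ?_⟩
  · have hper : ∀ n, (f⁻¹ ^ n) d = d ↔ f^[n] d = d := by
      intro n
      rw [inv_pow, Equiv.Perm.inv_eq_iff_eq, Equiv.Perm.iterate_eq_pow, eq_comm]
    have hp : Function.IsPeriodicPt f (l.length + 1) d := (hper _).1 hlen
    refine le_antisymm (hp.minimalPeriod_le (by omega)) ?_
    -- A smaller period would make `d` occur twice in the list.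
    by_contra hlt
    have hpos := hp.minimalPeriod_pos (by omega)
    have h1 := (hper _).2 (Function.iterate_minimalPeriod (f := f) (x := d))
    rw [key _ (by simp; omega)] at h1
    have := (hnd.getElem_inj_iff (i := Function.minimalPeriod f d) (j := 0)
      (hi := by simp; omega) (hj := by simp)).1 (by rw [h1]; rfl)
    omega
  · have hs : iterates f⁻¹ d (l.length + 1) =
        iterates f⁻¹ d l.length ++ [(f⁻¹ ^ (l.length + 1)) d] := by
      simp [iterates, List.range_succ]
    rw [hs, hit, hlen]

end RootedMap

-- Good paths and their equivalence classes

namespace Coding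

variable {C : ℕ → ℤ}

/-- A path starting from `0` whose steps are at most `1` and which, after every time, goes below its
present value. -/
structure IsGood (C : ℕ → ℤ) : Prop where
  zero : C 0 = 0
  step_le : ∀ n, C (n + 1) ≤ C n + 1
  exists_lt : ∀ n, ∃ m, n < m ∧ C m < C n

theorem extend_of_nonpos (h : IsGood C) {i : ℤ} (hi : i ≤ 0) : extend C i = i := by
  unfold extend
  split_ifs with h0
  · obtain rfl : i = 0 := by omega
    simp [h.zero]
  · rfl

theorem extend_natCast (n : ℕ) : extend C n = C n := by
  simp [extend]

theorem extend_succ_le (h : IsGood C) (i : ℤ) : extend C (i + 1) ≤ extend C i + 1 := by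
  rcases le_or_gt 0 i with hi | hi
  · lift i to ℕ using hi
    have := h.step_le i
    rw [← extend_natCast (C := C) i, ← extend_natCast (C := C) (i + 1)] at this
    exact_mod_cast this
  · rw [extend_of_nonpos h hi.le, extend_of_nonpos h (by omega)]

/-- Each use of `exists_lt` lowers the path by at least one, so it gets below any level, including
those of the negative half-line. -/
theorem exists_extend_lt (h : IsGood C) (i : ℤ) : ∃ j, i < j ∧ extend C j < extend C i := by
  have key : ∀ n : ℕ, ∀ v : ℤ, C n < v + n → ∃ j : ℕ, n ≤ j ∧ C j < v := by
    intro n v hv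
    have : ∀ k : ℕ, ∃ j : ℕ, n ≤ j ∧ C j ≤ C n - k := by
      intro k
      induction k with
      | zero => exact ⟨n, le_rfl, by simp⟩
      | succ k ih =>
        obtain ⟨j, h1, h2⟩ := ih
        obtain ⟨m, h3, h4⟩ := h.exists_lt j
        exact ⟨m, by omega, by push_cast; omega⟩
    obtain ⟨j, h1, h2⟩ := this n
    exact ⟨j, h1, by omega⟩
  rcases le_or_gt 0 i with hi | hi
  · lift i to ℕ using hi
    obtain ⟨m, h1, h2⟩ := h.exists_lt i
    exact ⟨m, by exact_mod_cast h1, by rwa [extend_natCast, extend_natCast]⟩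
  · have h0 : ∀ k : ℕ, ∃ j : ℕ, C j ≤ -k := by
      intro k
      induction k with
      | zero => exact ⟨0, by simp [h.zero]⟩
      | succ k ih =>
        obtain ⟨j, h2⟩ := ih
        obtain ⟨m, h3, h4⟩ := h.exists_lt j
        exact ⟨m, by push_cast; omega⟩
    obtain ⟨j, hj⟩ := h0 (1 - i).toNat
    refine ⟨j, by omega, ?_⟩
    rw [extend_natCast, extend_of_nonpos h hi.le]
    omega

theorem Equivalent.refl (i : ℤ) : Equivalent C i i :=
  ⟨rfl, fun k h1 h2 => by rw [show k = i by simp at h1 h2; omega]⟩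

/-- A class cannot cross a time with a lower value, and there is one on each side: `v` far on the
negative half-line, and a later time `k`. -/
theorem equivalent_finite (h : IsGood C) (i : ℤ) : {j : ℤ | Equivalent C j i}.Finite := by
  obtain ⟨k, hk, hlt⟩ := exists_extend_lt h i
  set v : ℤ := min (min i (extend C i)) 0 - 1
  have hv : extend C v = v := extend_of_nonpos h (by omega)
  refine (Set.finite_Icc v k).subset fun j hj => ?_
  obtain ⟨h1, h2⟩ := hj
  constructor
  · by_contra hlt
    have := h2 v (by omega) (by omega)
    omega
  · by_contra hgt
    have := h2 k (by omega) (by omega)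
    omega

theorem mem_classList_iff (h : IsGood C) {i j : ℤ} : j ∈ classList C i ↔ Equivalent C j i := by
  simp [classList, equivalent_finite h i]

theorem classList_sortedLT (h : IsGood C) (i : ℤ) : (classList C i).SortedLT := by
  simp only [classList, equivalent_finite h i, dite_true]
  exact Finset.sortedLT_sort _

/-- `i` and `j` are consecutive elements of an equivalence class. -/
def Consec (C : ℕ → ℤ) (i j : ℤ) : Prop :=
  i < j ∧ extend C i = extend C j ∧ ∀ k, i < k → k < j → extend C i < extend C k

theorem Consec.equivalent {i j : ℤ} (h : Consec C i j) : Equivalent C j i := by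
  obtain ⟨h1, h2, h3⟩ := h
  refine ⟨h2.symm, fun k hk1 hk2 => ?_⟩
  rcases eq_or_ne k i with rfl | hki
  · exact h2.ge
  rcases eq_or_ne k j with rfl | hkj
  · exact le_rfl
  · exact h2 ▸ (h3 k (by omega) (by omega)).le

/-- An element of the sorted class between `i` and `j` would have their common value, whereas the
path is strictly higher there. So `i` and `j` are adjacent in the list. -/
theorem next_of_consec (h : IsGood C) {i j : ℤ} (hij : Consec C i j) : next C i = j := by
  have hs := classList_sortedLT h i
  have hi : i ∈ classList C i := (mem_classList_iff h).2 (.refl i)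
  have hj : j ∈ classList C i := (mem_classList_iff h).2 hij.equivalent
  obtain ⟨a, ha, hai⟩ := List.getElem_of_mem hi
  obtain ⟨b, hb, hbj⟩ := List.getElem_of_mem hj
  have hm := hs.strictMono_get
  have hab : a < b := by
    by_contra hba
    have := hm.monotone (a := ⟨b, hb⟩) (b := ⟨a, ha⟩) (by simpa using hba)
    simp only [List.get_eq_getElem, hai, hbj] at this
    exact absurd hij.1 (by omega)
  have hb' : b = a + 1 := by
    by_contra hne
    have h1 := hm (a := ⟨a, ha⟩) (b := ⟨a + 1, by omega⟩) (by simp)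
    have h2 := hm (a := ⟨a + 1, by omega⟩) (b := ⟨b, hb⟩) (by simp; omega)
    simp only [List.get_eq_getElem, hai, hbj] at h1 h2
    have h3 := (mem_classList_iff h).1
      (List.getElem_mem (l := classList C i) (n := a + 1) (by omega))
    have h4 := hij.2.2 _ h1 h2
    rw [h3.1] at h4
    exact lt_irrefl _ h4
  subst hb'
  have := List.formPerm_apply_lt_getElem _ hs.nodup a hb
  rw [hai, hbj] at this
  exact this

theorem next_of_max_min (h : IsGood C) {i j : ℤ} (hij : Equivalent C j i)
    (hi : ∀ k, i < k → ¬ Equivalent C k i) (hj : ∀ k, k < j → ¬ Equivalent C k j) :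
    next C i = j := by
  have hs := classList_sortedLT h i
  have hm := hs.strictMono_get
  have hi' : i ∈ classList C i := (mem_classList_iff h).2 (.refl i)
  have hj' : j ∈ classList C i := (mem_classList_iff h).2 hij
  obtain ⟨a, ha, hai⟩ := List.getElem_of_mem hi'
  obtain ⟨b, hb, hbj⟩ := List.getElem_of_mem hj'
  have ha' : a + 1 = (classList C i).length := by
    by_contra hne
    have h1 := hm (a := ⟨a, ha⟩) (b := ⟨a + 1, by omega⟩) (by simp)
    simp only [List.get_eq_getElem, hai] at h1
    exact hi _ h1 ((mem_classList_iff h).1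
      (List.getElem_mem (l := classList C i) (n := a + 1) (by omega)))
  have hb' : b = 0 := by
    by_contra hne
    have h1 := hm (a := ⟨0, by omega⟩) (b := ⟨b, hb⟩) (by simp; omega)
    simp only [List.get_eq_getElem, hbj] at h1
    exact hj _ h1 (((mem_classList_iff h).1
      (List.getElem_mem (l := classList C i) (n := 0) (by omega))).trans hij.symm)
  subst hb'
  -- The index is taken modulo the length of the list, which sends the last element back to the
  -- first.
  have := List.formPerm_apply_getElem _ hs.nodup a ha
  simp only [hai, ha', Nat.mod_self, hbj] at this
  exact this

end Coding

theorem List.IsChain.cons_append_singleton {α : Type*} {R : α → α → Prop} {d e : α} {l : List α}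
    (h : List.IsChain R (d :: (l ++ [e]))) :
    List.IsChain R (d :: l) ∧ R ((d :: l).getLast (List.cons_ne_nil _ _)) e := by
  rw [← List.cons_append, List.isChain_append] at h
  exact ⟨h.1, h.2.2 _ (List.getLast_mem_getLast? _) _ (by simp)⟩

-- Corners and children in the looptree

namespace Coding

variable {C : ℕ → ℤ}

/-- The dart from `i` to `i + 1`. -/
def dartR (C : ℕ → ℤ) (i : ℤ) : (looptree C).Dart := Step.right i

/-- The dart from `i` to `i - 1`. -/
def dartL (C : ℕ → ℤ) (i : ℤ) : (looptree C).Dart := Step.left i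

theorem dartR_injective : Function.Injective (dartR C) := fun _ _ h => Step.right.inj h

theorem dartL_injective : Function.Injective (dartL C) := fun _ _ h => Step.left.inj h

theorem dartL_ne_dartR (i j : ℤ) : dartL C i ≠ dartR C j := fun h => by
  have : Step.left i = Step.right j := h
  cases this

theorem looptree_σ_dartL (i : ℤ) : (looptree C).σ (dartL C i) = dartR C i := rfl

theorem looptree_σ_dartR (i : ℤ) : (looptree C).σ (dartR C i) = dartL C (next C i) := rfl

theorem looptree_φ_dartR (i : ℤ) :
    (looptree C).φ (dartR C i) = dartR C ((next C).symm (i + 1)) := rfl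

theorem looptree_φ_dartL (i : ℤ) : (looptree C).φ (dartL C i) = dartL C (i - 1) := by
  rw [RootedMap.φ, Equiv.Perm.mul_apply, Equiv.Perm.inv_eq_iff_eq]
  rfl

theorem looptree_φ_pow_dartL (n : ℕ) (i : ℤ) :
    ((looptree C).φ ^ n) (dartL C i) = dartL C (i - n) := by
  induction n with
  | zero => simp
  | succ n ih =>
    rw [pow_succ', Equiv.Perm.mul_apply, ih, looptree_φ_dartL]
    push_cast
    rw [sub_sub]

theorem looptree_φ_pow_dartR (n : ℕ) (i : ℤ) :
    ∃ j, ((looptree C).φ ^ n) (dartR C i) = dartR C j := by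
  induction n with
  | zero => exact ⟨i, rfl⟩
  | succ n ih =>
    obtain ⟨j, hj⟩ := ih
    exact ⟨_, by rw [pow_succ', Equiv.Perm.mul_apply, hj, looptree_φ_dartR]⟩

/-- The face permutation preserves the direction of darts, and the root face is that of a left dart,
the reverse of the root edge. -/
theorem isInternal_dartR (i : ℤ) : (looptree C).IsInternal (dartR C i) := by
  rintro ⟨z, hz⟩
  change ((looptree C).φ ^ z) (dartL C (0 + 1)) = dartR C i at hz
  rcases z.eq_nat_or_neg with ⟨n, rfl | rfl⟩
  · rw [zpow_natCast, looptree_φ_pow_dartL] at hz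
    exact dartL_ne_dartR _ _ hz
  · rw [zpow_neg, zpow_natCast, Equiv.Perm.inv_eq_iff_eq] at hz
    obtain ⟨j, hj⟩ := looptree_φ_pow_dartR (C := C) n i
    rw [hj] at hz
    exact dartL_ne_dartR _ _ hz

/-- On left darts the face permutation is the translation by `-1`, so they all lie in a single
cycle. -/
theorem not_isInternal_dartL (i : ℤ) : ¬ (looptree C).IsInternal (dartL C i) := by
  refine not_not.2 ?_
  change (looptree C).φ.SameCycle (dartL C (0 + 1)) (dartL C i)
  rcases le_total i 1 with hi | hi
  · refine ⟨((1 - i).toNat : ℕ), ?_⟩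
    rw [zpow_natCast, looptree_φ_pow_dartL]
    congr 1
    omega
  · refine ⟨-((i - 1).toNat : ℕ), ?_⟩
    rw [zpow_neg, zpow_natCast, Equiv.Perm.inv_eq_iff_eq, looptree_φ_pow_dartL]
    congr 1
    omega

/-- The two darts at each time of a list. -/
def stepPairs (C : ℕ → ℤ) : List ℤ → List (looptree C).Dart
  | [] => []
  | s :: l => dartR C s :: dartL C s :: stepPairs C l

theorem mem_stepPairs {l : List ℤ} {s : ℤ} :
    (dartR C s ∈ stepPairs C l ↔ s ∈ l) ∧ (dartL C s ∈ stepPairs C l ↔ s ∈ l) := by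
  induction l with
  | nil => simp [stepPairs]
  | cons a l ih =>
    simp [stepPairs, ih, dartL_ne_dartR, (dartL_ne_dartR _ _).symm, dartR_injective.eq_iff,
      dartL_injective.eq_iff]

theorem nodup_stepPairs {l : List ℤ} (h : l.Nodup) : (stepPairs C l).Nodup := by
  induction l with
  | nil => simp [stepPairs]
  | cons a l ih =>
    have h' := List.nodup_cons.1 h
    simp [stepPairs, mem_stepPairs, h'.1, ih h'.2, (dartL_ne_dartR _ _).symm]

theorem isChain_stepPairs {t : ℤ} {l : List ℤ}
    (h : List.IsChain (fun x y => next C y = x) (t :: l)) :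
    List.IsChain (fun x y => (looptree C).σ y = x) (stepPairs C (t :: l)) := by
  induction l generalizing t with
  | nil => simp [stepPairs, looptree_σ_dartL]
  | cons s l ih =>
    rw [List.isChain_cons_cons] at h
    refine List.IsChain.cons_cons rfl (List.IsChain.cons_cons ?_ (ih h.2))
    rw [looptree_σ_dartR, h.1]

theorem getLast_stepPairs (t : ℤ) (l : List ℤ) (hne : stepPairs C (t :: l) ≠ []) :
    (stepPairs C (t :: l)).getLast hne = dartL C ((t :: l).getLast (List.cons_ne_nil _ _)) := by
  induction l generalizing t with
  | nil => rfl
  | cons s l ih =>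
    have := ih s (by simp [stepPairs])
    rw [List.getLast_cons (List.cons_ne_nil _ _), ← this]
    rfl

theorem filter_stepPairs (l : List ℤ) [DecidablePred (looptree C).IsInternal] :
    (stepPairs C l).filter (fun d => decide ((looptree C).IsInternal d)) = l.map (dartR C) := by
  induction l with
  | nil => rfl
  | cons a l ih =>
    rw [stepPairs, List.filter_cons_of_pos (by simpa using isInternal_dartR a),
      List.filter_cons_of_neg (by simpa using not_isInternal_dartL a), ih]
    rfl

/-- Turning clockwise from the right dart at `t` meets the left dart at `t`, then both darts at the
preceding element of the class, and so on cyclically. -/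
theorem iterates_σ {t : ℤ} {l : List ℤ} (hc : List.IsChain (fun x y => next C y = x) (t :: l))
    (hl : next C t = (t :: l).getLast (List.cons_ne_nil _ _)) (hnd : (t :: l).Nodup) :
    Function.minimalPeriod (looptree C).σ (dartR C t) = (dartL C t :: stepPairs C l).length + 1 ∧
      RootedMap.iterates (looptree C).σ⁻¹ (dartR C t) (dartL C t :: stepPairs C l).length =
        dartL C t :: stepPairs C l ∧
      RootedMap.iterates (looptree C).σ⁻¹ (dartR C t) ((dartL C t :: stepPairs C l).length + 1) =
        dartL C t :: stepPairs C l ++ [dartR C t] := by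
  refine RootedMap.iterates_inv_of_isChain (looptree C).σ (dartR C t)
    (dartL C t :: stepPairs C l) (isChain_stepPairs hc) ?_ (nodup_stepPairs hnd)
  rw [looptree_σ_dartR, hl]
  exact (getLast_stepPairs t l (by simp [stepPairs])).symm

/-- The white component at a time. -/
def whiteAt (C : ℕ → ℤ) (i : ℤ) : (looptree C).Component := .white (dartR C i)

/-- The black component at a time. -/
def blackAt (C : ℕ → ℤ) (i : ℤ) : (looptree C).Component := .black (dartR C i)

theorem kids_white {t : ℤ} {l : List ℤ}
    (h : List.IsChain (fun x y => next C y = x) (t :: (l ++ [t]))) (hnd : (t :: l).Nodup) :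
    (looptree C).componentKids (whiteAt C t) = l.map (blackAt C) := by
  obtain ⟨hc, hl⟩ := h.cons_append_singleton
  obtain ⟨h1, h2, -⟩ := iterates_σ hc hl hnd
  rw [whiteAt, RootedMap.componentKids.eq_def]
  simp only
  rw [h1, Nat.add_sub_cancel, h2,
    List.filter_cons_of_neg (by simpa using not_isInternal_dartL t), filter_stepPairs, List.map_map]
  rfl

/-- In contrast with other white vertices, the origin has no parent face. The corner at time `0` is
therefore kept, and it comes last. -/
theorem kids_origin {l : List ℤ}
    (h : List.IsChain (fun x y => next C y = x) (0 :: (l ++ [0]))) (hnd : (0 :: l).Nodup) :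
    (looptree C).componentKids .origin = (l ++ [0]).map (blackAt C) := by
  obtain ⟨hc, hl⟩ := h.cons_append_singleton
  obtain ⟨h1, -, h2⟩ := iterates_σ hc hl hnd
  rw [RootedMap.componentKids.eq_def]
  simp only
  rw [show (looptree C).root = dartR C 0 from rfl, h1, h2, List.cons_append,
    List.filter_cons_of_neg (by simpa using not_isInternal_dartL 0), List.filter_append,
    filter_stepPairs, List.filter_cons_of_pos (by simpa using isInternal_dartR 0), List.filter_nil,
    List.map_append, List.map_append, List.map_map]
  rfl

/-- The inverse face permutation sends the right dart at `x` to the one at `next C x - 1`, whence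
the relation in the chain. -/
theorem kids_black {i : ℤ} {l : List ℤ}
    (h : List.IsChain (fun x y => next C x = y + 1) (i :: (l ++ [i]))) (hnd : (i :: l).Nodup) :
    (looptree C).componentKids (blackAt C i) = l.map (whiteAt C) := by
  obtain ⟨hc, hl⟩ := h.cons_append_singleton
  have hφ : ∀ x y, next C x = y + 1 → (looptree C).φ (dartR C y) = dartR C x := by
    intro x y hxy
    rw [looptree_φ_dartR, ← hxy, Equiv.symm_apply_apply]
  obtain ⟨h1, h2, -⟩ := RootedMap.iterates_inv_of_isChain (looptree C).φ (dartR C i)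
    (l.map (dartR C)) (by
      rw [← List.map_cons, List.isChain_map]
      exact hc.imp fun x y => hφ x y)
    (by
      rw [hφ _ _ hl]
      simp only [← List.map_cons, List.getLast_map])
    (by
      rw [← List.map_cons]
      exact hnd.map dartR_injective)
  rw [blackAt, RootedMap.componentKids.eq_def]
  simp only
  rw [h1, Nat.add_sub_cancel, h2, List.map_map]
  rfl

-- Excursions and the forests they code

/-- After time `s`, the path stays above its value until it jumps to a value at most `v`. -/
def Exits (C : ℕ → ℤ) (s v : ℤ) : Prop :=
  ∃ e, s < e ∧ extend C e ≤ v ∧ ∀ k, s < k → k < e → extend C s < extend C k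

theorem Exits.not_equivalent {s v : ℤ} (h : Exits C s v) (hv : v < extend C s) (k : ℤ)
    (hk : s < k) : ¬ Equivalent C k s := by
  obtain ⟨e, h1, h2, h3⟩ := h
  intro hks
  by_cases hke : k < e
  · exact (h3 k hk hke).ne hks.1.symm
  · have := hks.2 e (by omega) (by omega)
    rw [hks.1] at this
    omega

/-- The exit makes `j` the last element of its class, and the rise just before `i + 1` makes `i + 1`
the first one. So `next` wraps around from `j` to `i + 1`. -/
theorem next_of_exits (h : IsGood C) {i j v : ℤ} (hij : Equivalent C (i + 1) j) (hv : Exits C j v)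
    (hvj : v < extend C j) (hi : extend C i < extend C (i + 1)) : next C j = i + 1 := by
  refine next_of_max_min h hij (hv.not_equivalent hvj) fun k hk hk' => ?_
  have := hk'.2 i (by omega) (by omega)
  rw [hk'.1] at this
  omega

/-- The steps of the path after time `s` are given by the list. -/
def Reads (C : ℕ → ℤ) : ℤ → List ℤ → Prop
  | _, [] => True
  | s, x :: w => extend C (s + 1) = extend C s + x ∧ Reads C (s + 1) w

theorem reads_append {s : ℤ} {u w : List ℤ} :
    Reads C s (u ++ w) ↔ Reads C s u ∧ Reads C (s + u.length) w := by
  induction u generalizing s with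
  | nil => simp [Reads]
  | cons a u ih =>
    simp only [List.cons_append, Reads, ih, and_assoc, List.length_cons]
    rw [show s + 1 + (u.length : ℤ) = s + ((u.length + 1 : ℕ) : ℤ) by push_cast; ring]

open CTree

theorem isChain_next (h : IsGood C) {l : List ℤ} (hc : List.IsChain (fun x y => Consec C y x) l) :
    List.IsChain (fun x y => next C y = x) l :=
  hc.imp fun _ _ hxy => next_of_consec h hxy

theorem nodup_of_isChain_gt {l : List ℤ} (hc : List.IsChain (fun x y => y < x) l) : l.Nodup :=
  (List.isChain_iff_pairwise.1 hc).imp fun hxy => hxy.ne'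

/-- Joint induction on the two kinds of words. A white word is an excursion whose returns to its
initial level are the corners carrying the black children. A black word is an unfinished excursion:
which corners belong to its face depends on the future, hence the hypothesis that the path later
exits to a level `v` not above the start. -/
theorem matchL_of_reads (h : IsGood C) (t : CTree) :
    (∀ s, Reads C s t.whiteWord →
      extend C (s + t.whiteWord.length) = extend C s ∧
      (∀ k, s ≤ k → k ≤ s + t.whiteWord.length → extend C s ≤ extend C k) ∧
      ∃ l : List ℤ, List.IsChain (fun x y => Consec C y x) ((s + t.whiteWord.length) :: l) ∧
        ((s + t.whiteWord.length) :: l).getLast (List.cons_ne_nil _ _) = s ∧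
        MatchL (looptree C).componentKids (l.map (blackAt C)) t) ∧
    (∀ s, Reads C s t.blackWord →
      extend C (s + t.blackWord.length) = extend C s + t.len ∧
      (∀ k, s < k → k ≤ s + t.blackWord.length → extend C s < extend C k) ∧
      ∀ v, v ≤ extend C s → Exits C (s + t.blackWord.length) v →
      ∃ l : List ℤ, List.IsChain (fun x y => next C x = y + 1) (l ++ [s]) ∧
        List.IsChain (fun x y => y < x) (l ++ [s]) ∧
        (l ++ [s]).head (by simp) = s + t.blackWord.length ∧
        MatchL (looptree C).componentKids (l.map (whiteAt C)) t) := by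
  induction t with
  | nil =>
    refine ⟨fun s _ => ?_, fun s _ => ?_⟩
    · simp only [whiteWord, List.length_nil, Nat.cast_zero, add_zero]
      refine ⟨trivial, fun k h1 h2 => by rw [show k = s by omega], [], by simp, rfl, rfl⟩
    · simp only [blackWord, List.length_nil, Nat.cast_zero, add_zero, len]
      exact ⟨trivial, fun k h1 h2 => by omega, fun v _ _ => ⟨[], by simp, by simp, rfl, rfl⟩⟩
  | cons b r ihb ihr =>
    refine ⟨fun s hs => ?_, fun s hs => ?_⟩
    · simp only [whiteWord, reads_append] at hs
      obtain ⟨hs1, hs2, hs3⟩ := hs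
      obtain ⟨hr1, hr2, lr, hr3, hr4, hr5⟩ := ihr.1 s hs1
      set s1 := s + (r.whiteWord.length : ℤ) with hs1e
      obtain ⟨hb1, hb2, hb3⟩ := ihb.2 s1 hs2
      set s2 := s1 + (b.blackWord.length : ℤ) with hs2e
      have he : s + ((cons b r).whiteWord.length : ℤ) = s2 + 1 := by
        simp [whiteWord, hs2e, hs1e]; ring
      rw [he]
      have hs21 : s1 ≤ s2 := by omega
      have hval : extend C (s2 + 1) = extend C s1 := by rw [hs3.1, hb1]; ring
      -- The closing step brings the path back to its level at `s1`. The face of the first child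
      -- lies between these two consecutive times.
      have hcon : Consec C s1 (s2 + 1) :=
        ⟨by omega, hval.symm, fun k h1 h2 => hb2 k h1 (by omega)⟩
      refine ⟨by rw [hval, hr1], fun k h1 h2 => ?_, s1 :: lr, ?_, ?_, ?_⟩
      · by_cases hk1 : k ≤ s1
        · exact hr2 k h1 hk1
        by_cases hk2 : k ≤ s2
        · exact hr1 ▸ (hb2 k (by omega) hk2).le
        · rw [show k = s2 + 1 by omega, hval, hr1]
      · exact List.IsChain.cons_cons hcon hr3
      · rw [List.getLast_cons (List.cons_ne_nil _ _), hr4]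
      -- Here the black word is completed at once, so the exit occurs at the very next time and
      -- reaches exactly the initial level.
      · obtain ⟨l, hl1, hl2, hl3, hl4⟩ := hb3 (extend C s1) le_rfl (by
          refine ⟨s2 + 1, by omega, hval.le, fun k h1 h2 => by omega⟩)
        refine ⟨blackAt C s1, lr.map (blackAt C), rfl, ?_, hr5⟩
        rw [kids_black (l := l)]
        · exact hl4
        · rw [List.isChain_cons]
          refine ⟨fun y hy => ?_, hl1⟩
          rw [← List.head_of_mem_head? hy, hl3, next_of_consec h hcon]
        · have := nodup_of_isChain_gt hl2
          exact (List.perm_append_singleton s1 l).nodup_iff.1 this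
    · simp only [blackWord, reads_append] at hs
      obtain ⟨hs1, hs2, hs3⟩ := hs
      obtain ⟨hr1, hr2, hr3⟩ := ihr.2 s hs1
      set s1 := s + (r.blackWord.length : ℤ) with hs1e
      obtain ⟨hb1, hb2, lb, hb3, hb4, hb5⟩ := ihb.1 (s1 + 1) hs3
      set s2 := s1 + 1 + (b.whiteWord.length : ℤ) with hs2e
      have he : s + ((cons b r).blackWord.length : ℤ) = s2 := by
        simp [blackWord, hs2e, hs1e]; ring
      rw [he]
      have hs21 : s1 < s2 := by omega
      have hval : extend C s2 = extend C s1 + 1 := by rw [hb1, hs2]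
      have hgt : ∀ k, s1 < k → k ≤ s2 → extend C s1 < extend C k := fun k h1 h2 => by
        have := hb2 k (by omega) h2
        omega
      refine ⟨by rw [hval, hr1, len]; push_cast; ring, fun k h1 h2 => ?_, fun v hv hex => ?_⟩
      · by_cases hk1 : k ≤ s1
        · exact hr2 k h1 hk1
        · have := hgt k (by omega) h2
          omega
      · have hvs2 : v < extend C s2 := by omega
        -- The path stays above its value at `s1` up to `s2`, so an exit from `s2` is also one from
        -- `s1`. This feeds the induction on the remaining trees.
        have hex1 : Exits C s1 v := by
          obtain ⟨e, h1, h2, h3⟩ := hex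
          refine ⟨e, by omega, h2, fun k h4 h5 => ?_⟩
          by_cases hk : k ≤ s2
          · exact hgt k h4 hk
          · have := h3 k (by omega) h5
            omega
        obtain ⟨l, hl1, hl2, hl3, hl4⟩ := hr3 v hv hex1
        -- The class visited between `s1 + 1` and `s2` starts with the up-step and ends at `s2`. The
        -- face therefore passes from corner `s2` to corner `s1`.
        have hnext : next C s2 = s1 + 1 := by
          refine next_of_exits h ⟨hb1.symm, fun k h1 h2 => hb2 k (by omega) (by omega)⟩ hex hvs2 ?_
          omega
        refine ⟨s2 :: l, ?_, ?_, by simp, whiteAt C s2, l.map (whiteAt C), rfl, ?_, hl4⟩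
        · rw [List.cons_append, List.isChain_cons]
          refine ⟨fun y hy => ?_, hl1⟩
          rw [← List.head_of_mem_head? hy, hl3, hnext]
        · rw [List.cons_append, List.isChain_cons]
          refine ⟨fun y hy => ?_, hl2⟩
          rw [← List.head_of_mem_head? hy, hl3]
          exact hs21
        · rw [kids_white (l := lb)]
          · exact hb5
          · rw [← List.cons_append, List.isChain_append]
            refine ⟨isChain_next h hb3, by simp, fun x hx y hy => ?_⟩
            simp only [List.head?_cons, Option.mem_def, Option.some.injEq] at hy
            rw [List.getLast?_eq_getLast_of_ne_nil (List.cons_ne_nil _ _), hb4,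
              Option.mem_def, Option.some.injEq] at hx
            rw [← hy, ← hx, hnext]
          · exact nodup_of_isChain_gt (hb3.imp fun x y hxy => hxy.1)

end Coding

-- The spine of the looptree

namespace Coding

open CTree

variable {C : ℕ → ℤ}

/-- `V` is the minimal value of the path up to time `m`, and is reached at this time. -/
def SpineAt (C : ℕ → ℤ) (V m : ℤ) : Prop :=
  V ≤ 0 ∧ 0 ≤ m ∧ extend C m = V ∧ ∀ k, V < k → k < m → V < extend C k

/-- The white vertex of the spine whose class contains `V` and `m`. -/
def spineState (C : ℕ → ℤ) (V m : ℤ) : (looptree C).Component :=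
  if m = V then .origin else whiteAt C V

/-- Times whose class is a singleton are traversed by a face one after the other, in decreasing
order. -/
theorem isChain_descend (n : ℕ) {x u : ℤ} {l : List ℤ} (hx : next C x = u)
    (hs : ∀ v, u - n ≤ v → v < u → next C v = v)
    (hl : List.IsChain (fun x y => next C x = y + 1) ((u - 1 - n) :: l)) :
    List.IsChain (fun x y => next C x = y + 1)
      (x :: ((List.range n).map (fun i : ℕ => u - 1 - (i : ℤ)) ++ (u - 1 - n) :: l)) := by
  induction n generalizing x u with
  | zero =>
    simp only [List.range_zero, List.map_nil, List.nil_append]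
    exact List.IsChain.cons_cons (by simp [hx]) hl
  | succ n ih =>
    have := @ih (u - 1) (u - 1) (hs _ (by push_cast; omega) (by omega))
      (fun v h1 h2 => hs v (by push_cast; omega) (by omega))
      (by rwa [show u - 1 - 1 - (n : ℤ) = u - 1 - ((n + 1 : ℕ) : ℤ) by push_cast; ring])
    have h1 : u - 1 - ((n + 1 : ℕ) : ℤ) = u - 1 - 1 - n := by push_cast; ring
    have h2 : (List.range n).map ((fun i : ℕ => u - 1 - (i : ℤ)) ∘ Nat.succ) =
        (List.range n).map fun i : ℕ => u - 1 - 1 - (i : ℤ) :=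
      List.map_congr_left fun i _ => by simp only [Function.comp_apply]; push_cast; ring
    rw [List.range_succ_eq_map, List.map_cons, List.map_map, List.cons_append, h1, h2]
    refine List.IsChain.cons_cons (by simp [hx]) ?_
    simpa using this

/-- The inductive step along the spine. With `j` the last visit to level `V`, the face at corner `j`
goes round through `next C j = V` down the negative half-line to `V - 1 - b.k`, then jumps to the
landing time of the block and comes back down the climb. The last class on the half-line also
contains this landing time, so it is the next spine vertex. -/
theorem kids_spine (h : IsGood C) {b : Block} {V m : ℤ} (hs : SpineAt C V m)
    (hr : Reads C m b.word) :
    SpineAt C (V - 1 - b.k) (m + b.word.length) ∧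
    ∃ (j : ℤ) (l₁ l₂ : List ℤ),
      (looptree C).componentKids (spineState C V m) = blackAt C j :: l₁.map (blackAt C) ∧
      MatchL (looptree C).componentKids (l₁.map (blackAt C)) b.right ∧
      (looptree C).componentKids (blackAt C j) =
        (List.range b.k).map (fun i : ℕ => whiteAt C (V - 1 - (i : ℤ))) ++
          whiteAt C (V - 1 - b.k) :: l₂.map (whiteAt C) ∧
      MatchL (looptree C).componentKids (l₂.map (whiteAt C)) b.above ∧
      ∀ i, i < b.k → (looptree C).componentKids (whiteAt C (V - 1 - (i : ℤ))) = [] := by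
  obtain ⟨hV, hm, hmV, hVk⟩ := hs
  simp only [Block.word, reads_append] at hr
  obtain ⟨hr1, hr2, hr3, -⟩ := hr
  obtain ⟨hw1, hw2, lw, hw3, hw4, hw5⟩ := (matchL_of_reads h b.right).1 m hr1
  set j := m + (b.right.whiteWord.length : ℤ) with hje
  obtain ⟨hb1, hb2, hb3⟩ := (matchL_of_reads h b.above).2 j hr2
  set s := j + (b.above.blackWord.length : ℤ) with hse
  have he : m + (b.word.length : ℤ) = s + 1 := by
    simp [Block.word, hje, hse]; ring
  rw [he]
  have hXj : extend C j = V := by rw [hw1, hmV]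
  have hXe : extend C (s + 1) = V - 1 - b.k := by rw [hr3, hb1, hXj]; ring
  have hlow : ∀ k, k ≤ 0 → extend C k = k := fun k hk => extend_of_nonpos h hk
  have hXV : ∀ k, V ≤ k → k ≤ s → V ≤ extend C k := by
    intro k h1 h2
    rcases eq_or_lt_of_le h1 with rfl | h1
    · rw [hlow _ hV]
    by_cases hk : k < m
    · exact (hVk k h1 hk).le
    by_cases hk' : k ≤ j
    · exact hmV ▸ hw2 k (by omega) hk'
    · exact hXj ▸ (hb2 k (by omega) h2).le
  -- Before the block ends, the path is above any `v < V` from time `v` on: by the identity below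
  -- `V`, and by minimality of `V` afterwards.
  have hXlow : ∀ v, v < V → ∀ k, v < k → k ≤ s → v < extend C k := by
    intro v hv k h1 h2
    by_cases hk : V ≤ k
    · have := hXV k hk h2
      omega
    · rw [hlow k (by omega)]
      exact h1
  have hexj : Exits C j (V - 1 - b.k) :=
    ⟨s + 1, by omega, hXe.le, fun k h1 h2 => hb2 k h1 (by omega)⟩
  have hnj : next C j = V := by
    have := next_of_exits h (i := V - 1) (j := j) (v := V - 1 - b.k) ⟨?_, fun k h1 h2 => ?_⟩ hexj
      (by omega) (by rw [hlow _ (by omega), hlow _ (by omega)]; omega)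
    · rw [this]; ring
    · rw [hXj, hlow _ (by omega)]; ring
    · rw [hlow (V - 1 + 1) (by omega), sub_add_cancel]
      exact hXV k (by omega) (by omega)
  -- The final jump passes strictly below such a `v`, and so does the path at time `v - 1`: the
  -- class of `v` is reduced to `v`.
  have hsingle : ∀ v, V - b.k ≤ v → v < V → next C v = v := by
    intro v h1 h2
    have := next_of_exits h (i := v - 1) (j := v) (v := V - 1 - b.k) (by
      rw [sub_add_cancel]; exact .refl v)
      ⟨s + 1, by omega, hXe.le, fun k h3 h4 => by
        rw [hlow v (by omega)]; exact hXlow v h2 k h3 (by omega)⟩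
      (by rw [hlow v (by omega)]; omega)
      (by rw [hlow _ (by omega), hlow _ (by omega)]; omega)
    rw [this, sub_add_cancel]
  have hcon : Consec C (V - 1 - b.k) (s + 1) :=
    ⟨by omega, by rw [hXe, hlow _ (by omega)], fun k h1 h2 => by
      rw [hlow (V - 1 - b.k) (by omega)]; exact hXlow _ (by omega) k h1 (by omega)⟩
  refine ⟨⟨by omega, by omega, hXe, fun k h1 h2 => hXlow _ (by omega) k h1 (by omega)⟩, ?_⟩
  obtain ⟨l, hl1, hl2, hl3, hl4⟩ := hb3 (V - 1 - b.k) (by omega)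
    ⟨s + 1, by omega, hXe.le, fun k h1 h2 => by omega⟩
  refine ⟨j, lw, l, ?_, hw5, ?_, hl4, ?_⟩
  · have hnd := nodup_of_isChain_gt (hw3.imp fun x y hxy => hxy.1)
    have hwn := isChain_next h hw3
    unfold spineState
    split_ifs with hmV'
    -- Since `V ≤ 0 ≤ m`, equality forces both to vanish: this is the origin.
    · have hm0 : m = 0 := by omega
      obtain ⟨l', hl'⟩ : ∃ l', j :: lw = l' ++ [0] := by
        refine ⟨(j :: lw).dropLast, ?_⟩
        conv_lhs => rw [← List.dropLast_concat_getLast (List.cons_ne_nil j lw), hw4, hm0]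
      rw [← List.map_cons, hl']
      refine kids_origin ?_ ?_
      · rw [← hl']
        exact List.IsChain.cons_cons (by rw [hnj]; omega) hwn
      · rw [hl'] at hnd
        exact (List.perm_append_singleton 0 l').nodup_iff.1 hnd
    · have hVm : V < m := by omega
      have hVmc : Consec C V m := ⟨hVm, by rw [hlow V hV, hmV], fun k h1 h2 => by
        rw [hlow V hV]; exact hVk k h1 h2⟩
      rw [← List.map_cons]
      refine kids_white ?_ ?_
      · refine List.IsChain.cons_cons hnj (?_ : List.IsChain _ (j :: lw ++ [V]))
        rw [List.isChain_append]
        refine ⟨hwn, by simp, fun x hx y hy => ?_⟩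
        simp only [List.head?_cons, Option.mem_def, Option.some.injEq] at hy
        rw [List.getLast?_eq_getLast_of_ne_nil (List.cons_ne_nil _ _), hw4,
          Option.mem_def, Option.some.injEq] at hx
        rw [← hy, ← hx, next_of_consec h hVmc]
      · refine List.nodup_cons.2 ⟨fun hmem => ?_, hnd⟩
        have hge : ∀ (l : List ℤ) (hne : l ≠ []), List.IsChain (fun x y => Consec C y x) l →
            ∀ x ∈ l, l.getLast hne ≤ x := by
          intro l hne hc x hx
          have hp := List.isChain_iff_pairwise.1 (hc.imp fun x y hxy => (hxy.1 : y < x))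
          rcases eq_or_ne x (l.getLast hne) with rfl | hxl
          · exact le_rfl
          · rw [← List.dropLast_concat_getLast hne, List.pairwise_append] at hp
            rw [← List.dropLast_concat_getLast hne, List.mem_append, List.mem_singleton] at hx
            exact (hp.2.2 x (hx.resolve_right hxl) _ (by simp)).le
        have := hge _ (List.cons_ne_nil _ _) hw3 _ hmem
        rw [hw4] at this
        omega
  · have hmap : (List.range b.k).map (fun i : ℕ => whiteAt C (V - 1 - (i : ℤ))) ++
          whiteAt C (V - 1 - b.k) :: l.map (whiteAt C) =
        ((List.range b.k).map (fun i : ℕ => V - 1 - (i : ℤ)) ++ (V - 1 - b.k) :: l).map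
          (whiteAt C) := by
      simp
    rw [hmap]
    refine kids_black ?_ ?_
    · rw [List.append_assoc, List.cons_append]
      refine isChain_descend b.k hnj hsingle ?_
      rw [List.isChain_cons]
      refine ⟨fun y hy => ?_, hl1⟩
      rw [← List.head_of_mem_head? hy, hl3, next_of_consec h hcon]
    · have hl2' := List.isChain_iff_pairwise.1 hl2
      rw [List.pairwise_append] at hl2'
      have hgt : ∀ x ∈ l, j < x := fun x hx => hl2'.2.2 x hx j (by simp)
      have hrange : (List.range b.k).map (fun i : ℕ => V - 1 - (i : ℤ)) ++ [V - 1 - (b.k : ℤ)] =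
          (List.range (b.k + 1)).map (fun i : ℕ => V - 1 - (i : ℤ)) := by
        rw [List.range_succ, List.map_append, List.map_singleton]
      rw [List.append_cons, hrange]
      have hlt : ∀ x ∈ (List.range (b.k + 1)).map (fun i : ℕ => V - 1 - (i : ℤ)), x < j := by
        intro x hx
        obtain ⟨i, -, rfl⟩ := List.mem_map.1 hx
        omega
      refine List.nodup_cons.2 ⟨fun hmem => ?_, List.nodup_append.2 ⟨?_, ?_, ?_⟩⟩
      · rcases List.mem_append.1 hmem with hmem | hmem
        · exact lt_irrefl _ (hlt _ hmem)
        · exact lt_irrefl _ (hgt _ hmem)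
      · exact List.nodup_range.map fun a c hac => by simpa using hac
      · exact hl2'.1.imp fun hxy => hxy.ne'
      · intro x hx y hy
        exact ((hlt x hx).trans (hgt y hy)).ne
  · intro i hi
    have := @kids_white C (V - 1 - (i : ℤ)) [] ?_ (by simp)
    · simpa using this
    · exact List.IsChain.cons_cons (hsingle _ (by omega) (by omega)) (by simp)

/-- Each block accounts for two generations. The part beyond the given blocks lies only above the
last spine vertex, at height `2 * d.length`. -/
theorem agree_of_reads (h : IsGood C) (d : List Block) {V m : ℤ} (hs : SpineAt C V m)
    (hr : Reads C m (d.flatMap Block.word)) :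
    PlaneTree.Agree (looptree C).componentKids CTree.kids (2 * d.length) (spineState C V m)
      (Block.toTree d) := by
  induction d generalizing V m with
  | nil => trivial
  | cons b d ih =>
    rw [List.flatMap_cons, reads_append] at hr
    obtain ⟨hs', j, l₁, l₂, h1, h2, h3, h4, h5⟩ := kids_spine h hs hr.1
    have hih := ih hs' hr.2
    rw [show 2 * (b :: d).length = 2 * d.length + 1 + 1 by simp; ring, PlaneTree.Agree, h1,
      Block.toTree, kids]
    refine List.Forall₂.cons ?_ (PlaneTree.agree_of_matchL h2 _)
    rw [PlaneTree.Agree, h3, kids_ofList]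
    refine List.rel_append ?_ (List.Forall₂.cons ?_ (PlaneTree.agree_of_matchL h4 _))
    · rw [List.forall₂_iff_get]
      refine ⟨by simp, fun i hi hi' => ?_⟩
      simp only [List.get_eq_getElem, List.getElem_map, List.getElem_range, List.getElem_replicate]
      exact PlaneTree.Agree.of_matchL (t := .nil) (by rw [MatchL]; exact h5 i (by simpa using hi)) _
    -- After a block the level is negative and the time nonnegative, so the new spine vertex is not
    -- the origin.
    · rwa [spineState, if_neg (by have := hs'.1; have := hs.2.1; have := hs.1; omega)] at hih

theorem spineAt_zero (h : IsGood C) : SpineAt C 0 0 :=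
  ⟨le_rfl, le_rfl, extend_of_nonpos h le_rfl, fun k h1 h2 => by omega⟩

theorem ball_componentTree (h : IsGood C) {d : List Block} (hr : Reads C 0 (d.flatMap Block.word))
    {R : ℕ} (hR : R ≤ 2 * d.length) :
    (componentTree C).ball R = (PlaneTree.unfold CTree.kids (Block.toTree d)).ball R :=
  PlaneTree.Agree.ball_eq ((agree_of_reads h d (spineAt_zero h) hr).mono hR)

/-! ### Parsing -/

theorem exists_last {p : ℤ → Prop} {a b : ℤ} (hab : a ≤ b) (ha : p a) :
    ∃ c, a ≤ c ∧ c ≤ b ∧ p c ∧ ∀ k, c < k → k ≤ b → ¬ p k := by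
  obtain ⟨c, ⟨h1, h2⟩, h3⟩ := Int.exists_greatest_of_bdd (P := fun k => k ≤ b ∧ p k)
    ⟨b, fun k hk => hk.1⟩ ⟨a, hab, ha⟩
  exact ⟨c, h3 a ⟨hab, ha⟩, h1, h2, fun k hk hkb hpk => by
    have := h3 k ⟨hkb, hpk⟩
    omega⟩

/-- Last-passage decompositions, by induction on the length of the interval. An excursion is cut at
its previous visit to its level, and a climb at its last time strictly below its final value. The
pieces are coded by shorter words. -/
theorem exists_reads (h : IsGood C) (n : ℕ) : ∀ s s' : ℤ, s ≤ s' → s' - s < n →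
    (extend C s' = extend C s → (∀ k, s ≤ k → k ≤ s' → extend C s ≤ extend C k) →
      ∃ t : CTree, Reads C s t.whiteWord ∧ s + t.whiteWord.length = s') ∧
    ((∀ k, s < k → k ≤ s' → extend C s < extend C k) →
      ∃ t : CTree, Reads C s t.blackWord ∧ s + t.blackWord.length = s' ∧
        extend C s' = extend C s + t.len) := by
  induction n with
  | zero => intro s s' h1 h2; exact absurd h2 (by simp; omega)
  | succ n ih =>
    intro s s' hss' hn
    push_cast at hn
    refine ⟨fun hX hge => ?_, fun hgt => ?_⟩
    · rcases eq_or_lt_of_le hss' with rfl | hlt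
      · exact ⟨.nil, trivial, by simp [whiteWord]⟩
      obtain ⟨c, hc1, hc2, hc3, hc4⟩ := exists_last (p := fun k => extend C k = extend C s)
        (a := s) (b := s' - 1) (by omega) rfl
      obtain ⟨r, hr1, hr2⟩ := (ih s c hc1 (by omega)).1 hc3
        fun k h1 h2 => hge k h1 (by omega)
      obtain ⟨b, hb1, hb2, hb3⟩ := (ih c (s' - 1) hc2 (by omega)).2 fun k h1 h2 => by
        have h3 := hge k (by omega) (by omega)
        have h4 := hc4 k h1 h2
        omega
      refine ⟨.cons b r, ?_, ?_⟩
      · rw [whiteWord, reads_append, reads_append, hr2, hb2]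
        refine ⟨hr1, hb1, ?_, trivial⟩
        rw [sub_add_cancel, hX, hb3, hc3]
        ring
      · simp only [whiteWord, List.length_append, List.length_singleton]
        push_cast
        omega
    · rcases eq_or_lt_of_le hss' with rfl | hlt
      · exact ⟨.nil, trivial, by simp [blackWord], by simp [len]⟩
      obtain ⟨c, hc1, hc2, hc3, hc4⟩ := exists_last (p := fun k => extend C k < extend C s')
        (a := s) (b := s') hss' (hgt s' hlt le_rfl)
      have hcs' : c < s' := lt_of_le_of_ne hc2 fun hcs => by
        subst hcs
        exact lt_irrefl _ hc3
      -- Steps are at most `1`, so the path cannot skip the final value when it stops being below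
      -- it.
      have hup : extend C (c + 1) = extend C s' ∧ extend C s' = extend C c + 1 := by
        have h1 := hc4 (c + 1) (by omega) (by omega)
        have h2 := extend_succ_le h c
        omega
      obtain ⟨r, hr1, hr2, hr3⟩ := (ih s c hc1 (by omega)).2 fun k h1 h2 => hgt k h1 (by omega)
      obtain ⟨w, hw1, hw2⟩ := (ih (c + 1) s' (by omega) (by omega)).1 hup.1.symm fun k h1 h2 => by
        have := hc4 k (by omega) h2
        omega
      refine ⟨.cons w r, ?_, ?_, ?_⟩
      · rw [blackWord, reads_append, hr2]
        exact ⟨hr1, by rw [hup.1, hup.2], hw1⟩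
      · simp only [blackWord, List.length_append, List.length_cons]
        push_cast
        omega
      · rw [hup.2, hr3, len]
        push_cast
        ring

/-- The block ends at the first passage `e` strictly below the present level. The last visit `c` to
this level before `e` separates the white excursion from the climb. -/
theorem exists_block (h : IsGood C) (m : ℤ) : ∃ b : Block, Reads C m b.word := by
  obtain ⟨e, ⟨he1, he2⟩, he3⟩ := Int.exists_least_of_bdd
    (P := fun k => m < k ∧ extend C k < extend C m) ⟨m, fun k hk => hk.1.le⟩ (exists_extend_lt h m)
  have hge : ∀ k, m ≤ k → k < e → extend C m ≤ extend C k := fun k h1 h2 => by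
    rcases eq_or_lt_of_le h1 with rfl | h1
    · exact le_rfl
    by_contra hlt
    have := he3 k ⟨h1, by omega⟩
    omega
  obtain ⟨c, hc1, hc2, hc3, hc4⟩ := exists_last (p := fun k => extend C k = extend C m)
    (a := m) (b := e - 1) (by omega) rfl
  obtain ⟨r, hr1, hr2⟩ := (exists_reads h (c - m + 1).toNat m c hc1 (by omega)).1 hc3
    fun k h1 h2 => hge k h1 (by omega)
  obtain ⟨b, hb1, hb2, hb3⟩ := (exists_reads h (e - 1 - c + 1).toNat c (e - 1) hc2 (by omega)).2
    fun k h1 h2 => by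
      have h3 := hge k (by omega) (by omega)
      have h4 := hc4 k h1 h2
      omega
  -- The number of bare children is the depth of the jump below the level, minus one for the next
  -- spine vertex.
  refine ⟨⟨r, (extend C m - extend C e - 1).toNat, b⟩, ?_⟩
  simp only [Block.word, reads_append, hr2, hb2]
  refine ⟨hr1, hb1, ?_, trivial⟩
  rw [sub_add_cancel, hb3, hc3]
  omega

theorem exists_blocks (h : IsGood C) (n : ℕ) (m : ℤ) :
    ∃ d : List Block, d.length = n ∧ Reads C m (d.flatMap Block.word) := by
  induction n generalizing m with
  | zero => exact ⟨[], rfl, trivial⟩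
  | succ n ih =>
    obtain ⟨b, hb⟩ := exists_block h m
    obtain ⟨d, rfl, hd⟩ := ih (m + b.word.length)
    exact ⟨b :: d, rfl, by rw [List.flatMap_cons, reads_append]; exact ⟨hb, hd⟩⟩

end Coding

/-! ## Recurrence of the walk -/

namespace Walk

/-- The partial sums of a sequence. -/
def partialSum (x : ℕ → ℤ) (n : ℕ) : ℤ := ∑ i ∈ Finset.range n, x i

theorem partialSum_succ (x : ℕ → ℤ) (n : ℕ) : partialSum x (n + 1) = partialSum x n + x n :=
  Finset.sum_range_succ _ _

/-- The sequence after time `j`. -/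
def shift (j : ℕ) (x : ℕ → ℤ) : ℕ → ℤ := fun n => x (j + n)

theorem partialSum_shift (x : ℕ → ℤ) (j k : ℕ) :
    partialSum (shift j x) k = partialSum x (j + k) - partialSum x j := by
  rw [partialSum, partialSum, partialSum, Finset.sum_range_add, add_sub_cancel_left]
  rfl

@[fun_prop]
theorem measurable_partialSum : Measurable partialSum := by
  refine measurable_pi_lambda _ fun n => ?_
  unfold partialSum
  fun_prop

@[fun_prop]
theorem measurable_shift (j : ℕ) : Measurable (shift j) :=
  measurable_pi_lambda _ fun _ => measurable_pi_apply _

/-- The law of the sequence of steps. -/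
noncomputable def stepsLaw (ν : Measure ℤ) : Measure (ℕ → ℤ) := Measure.infinitePi fun _ : ℕ => ν

theorem walkLaw_eq (ν : Measure ℤ) : walkLaw ν = (stepsLaw ν).map partialSum := rfl

variable (ν : Measure ℤ) [IsProbabilityMeasure ν]

instance : IsProbabilityMeasure (stepsLaw ν) := by unfold stepsLaw; infer_instance

theorem map_shift (j : ℕ) : (stepsLaw ν).map (shift j) = stepsLaw ν :=
  Measure.map_infinitePi_infinitePi_of_inj (P := fun _ : ℕ => ν) (f := fun n => j + n)
    (add_right_injective j)

/-- The sequence with a given first term and given other terms. -/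
def consMap (p : ℤ × (ℕ → ℤ)) : ℕ → ℤ
  | 0 => p.1
  | n + 1 => p.2 n

theorem measurable_consMap : Measurable consMap := by
  refine measurable_pi_lambda _ fun n => ?_
  cases n with
  | zero => exact measurable_fst
  | succ n => exact (measurable_pi_apply n).comp measurable_snd

theorem map_consMap : (ν.prod (stepsLaw ν)).map consMap = stepsLaw ν := by
  refine Measure.eq_infinitePi _ fun s t ht => ?_
  rw [Measure.map_apply measurable_consMap (.pi s.countable_toSet fun i _ => ht i)]
  classical
  set s' : Finset ℕ := s.preimage (· + 1) (add_left_injective 1).injOn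
  have hpre : consMap ⁻¹' (Set.pi s t) =
      (if 0 ∈ s then t 0 else Set.univ) ×ˢ (Set.pi s' fun n => t (n + 1)) := by
    ext ⟨a, x⟩
    simp only [Set.mem_preimage, Set.mem_pi, Finset.mem_coe, Set.mem_prod, s', Finset.mem_preimage]
    constructor
    · intro h
      refine ⟨?_, fun i hi => h (i + 1) hi⟩
      split_ifs with h0
      · exact h 0 h0
      · trivial
    · rintro ⟨h1, h2⟩ i hi
      cases i with
      | zero => rwa [if_pos hi] at h1
      | succ i => exact h2 i hi
  rw [hpre, Measure.prod_prod, stepsLaw, Measure.infinitePi_pi _ fun i _ => ht _]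
  have himg : s'.map ⟨(· + 1), add_left_injective 1⟩ = s.erase 0 := by
    ext i
    simp only [Finset.mem_map, Function.Embedding.coeFn_mk, Finset.mem_erase, s',
      Finset.mem_preimage]
    constructor
    · rintro ⟨a, ha, rfl⟩
      exact ⟨by omega, ha⟩
    · rintro ⟨h1, h2⟩
      exact ⟨i - 1, by rwa [Nat.sub_add_cancel (by omega)], by omega⟩
  have hprod : ∏ i ∈ s', ν (t (i + 1)) = ∏ i ∈ s.erase 0, ν (t i) := by
    rw [← himg, Finset.prod_map]
    rfl
  rw [hprod]
  split_ifs with h0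
  · exact Finset.mul_prod_erase s (fun i => ν (t i)) h0
  · rw [measure_univ, one_mul, Finset.erase_eq_of_notMem h0]

variable {ν}

theorem ae_tendsto_partialSum (h : IsStepLaw ν) :
    ∀ᵐ x ∂stepsLaw ν, Filter.Tendsto (fun n : ℕ => (partialSum x n : ℝ) / n) Filter.atTop
      (nhds 0) := by
  have hmp : ∀ i, MeasurePreserving (fun x : ℕ → ℤ => x i) (stepsLaw ν) ν := fun i =>
    measurePreserving_eval_infinitePi (fun _ : ℕ => ν) i
  have hm : Measurable fun k : ℤ => (k : ℝ) := by fun_prop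
  have hmap : ∀ i, (stepsLaw ν).map (fun x => ((x i : ℤ) : ℝ)) = ν.map fun k : ℤ => (k : ℝ) :=
    fun i => (Measure.map_map hm (hmp i).measurable).symm.trans (by rw [(hmp i).map_eq])
  have := strong_law_ae_real (μ := stepsLaw ν) (fun i x => ((x i : ℤ) : ℝ))
    ((hmp 0).integrable_comp_of_integrable h.integrable)
    (fun i j hij => (iIndepFun_infinitePi (P := fun _ : ℕ => ν) (X := fun _ (k : ℤ) => (k : ℝ))
      fun _ => hm).indepFun hij)
    (fun i => ⟨(hm.comp (hmp i).measurable).aemeasurable, (hm.comp (hmp 0).measurable).aemeasurable,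
      (hmap i).trans (hmap 0).symm⟩)
  have h0 : ∫ x, ((x 0 : ℤ) : ℝ) ∂stepsLaw ν = 0 :=
    ((hmp 0).hasLaw.integral_comp hm.aestronglyMeasurable).trans h.centered
  rw [h0] at this
  filter_upwards [this] with x hx
  simpa [partialSum] using hx

/-- The sequences with nonnegative partial sums. -/
def staysNonneg : Set (ℕ → ℤ) := {x | ∀ k, 0 ≤ partialSum x k}

theorem measurableSet_staysNonneg : MeasurableSet staysNonneg := by
  have : staysNonneg = ⋂ k : ℕ, (fun x => partialSum x k) ⁻¹' Set.Ici 0 := by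
    ext x; simp [staysNonneg]
  rw [this]
  exact MeasurableSet.iInter fun k =>
    ((measurable_pi_apply k).comp measurable_partialSum) measurableSet_Ici

/-- The sequences which start with `1` and whose partial sums stay positive afterwards. -/
def staysPos : Set (ℕ → ℤ) := {x | x 0 = 1 ∧ shift 1 x ∈ staysNonneg}

theorem measurableSet_staysPos : MeasurableSet staysPos :=
  ((measurable_pi_apply 0) (measurableSet_singleton 1)).inter
    (measurable_shift 1 measurableSet_staysNonneg)

theorem measure_staysPos : stepsLaw ν staysPos = ν {1} * stepsLaw ν staysNonneg := by
  conv_lhs => rw [← map_consMap, Measure.map_apply measurable_consMap measurableSet_staysPos]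
  rw [← Measure.prod_prod]
  congr 1
  ext ⟨a, x⟩
  simp only [Set.mem_preimage, staysPos, Set.mem_ofPred_eq, Set.mem_prod, Set.mem_singleton_iff]
  have : shift 1 (consMap (a, x)) = x := by
    funext n
    rw [shift, add_comm]
    rfl
  rw [this]
  rfl

theorem lt_of_shift_mem_staysPos {x : ℕ → ℤ} {j k : ℕ} (hj : shift j x ∈ staysPos) (hjk : j < k) :
    partialSum x j < partialSum x k := by
  obtain ⟨h1, h2⟩ := hj
  have h3 := h2 (k - j - 1)
  have h4 : shift 1 (shift j x) = shift (j + 1) x := by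
    funext n; simp only [shift, add_assoc]
  rw [h4, partialSum_shift, partialSum_succ, show j + 1 + (k - j - 1) = k by omega] at h3
  have h5 : x j = 1 := h1
  omega

/-- A sequence which is `o(n)` has a running maximum which is `o(n)`: the finitely many early terms
are eventually dominated by `ε * n`. -/
theorem eventually_forall_le {u : ℕ → ℝ}
    (h : Filter.Tendsto (fun n : ℕ => u n / n) Filter.atTop (nhds 0)) {ε : ℝ} (hε : 0 < ε) :
    ∀ᶠ n : ℕ in Filter.atTop, ∀ j ≤ n, |u j| ≤ ε * n := by
  have h1 : ∀ᶠ n : ℕ in Filter.atTop, |u n| ≤ ε * n := by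
    filter_upwards [(Metric.tendsto_nhds.1 h) ε hε, Filter.eventually_gt_atTop 0] with n hn h0
    have h0' : (0 : ℝ) < n := by exact_mod_cast h0
    rw [dist_zero_right, Real.norm_eq_abs, abs_div, abs_of_pos h0', div_lt_iff₀ h0'] at hn
    exact hn.le
  obtain ⟨N, hN⟩ := Filter.eventually_atTop.1 h1
  obtain ⟨M, hM⟩ := exists_nat_ge ((∑ j ∈ Finset.range N, |u j|) / ε)
  filter_upwards [Filter.eventually_ge_atTop M] with n hn j hj
  by_cases hjN : N ≤ j
  · refine (hN j hjN).trans ?_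
    gcongr
  · have h2 : |u j| ≤ ∑ j ∈ Finset.range N, |u j| :=
      Finset.single_le_sum (f := fun j => |u j|) (fun i _ => abs_nonneg _)
        (Finset.mem_range.2 (by omega))
    rw [div_le_iff₀ hε] at hM
    have h3 : (M : ℝ) * ε ≤ n * ε := by gcongr
    linarith

/-- At times after which the path stays strictly higher, it takes distinct values, and few integers
are available in `[-M, M]`. -/
theorem card_le_of_abs_le {u : ℕ → ℤ} {J : Finset ℕ} {M : ℝ} (hM : 0 ≤ M)
    (hJ : ∀ j ∈ J, ∀ k, j < k → u j < u k) (hb : ∀ j ∈ J, |(u j : ℝ)| ≤ M) :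
    (J.card : ℝ) ≤ 2 * M + 1 := by
  have hinj : Set.InjOn u J := by
    intro a ha b hb hab
    by_contra hne
    rcases lt_or_gt_of_ne hne with hlt | hlt
    · exact (hJ a ha b hlt).ne hab
    · exact (hJ b hb a hlt).ne hab.symm
  have hsub : J.image u ⊆ Finset.Icc (-⌊M⌋) ⌊M⌋ := by
    intro k hk
    obtain ⟨j, hj, rfl⟩ := Finset.mem_image.1 hk
    have h1 := abs_le.1 (hb j hj)
    rw [Finset.mem_Icc]
    refine ⟨?_, Int.le_floor.2 h1.2⟩
    rw [neg_le]
    exact Int.le_floor.2 (by push_cast; linarith [h1.1])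
  have h1 := Finset.card_le_card hsub
  rw [Finset.card_image_of_injOn hinj, Int.card_Icc] at h1
  have h2 : (0 : ℤ) ≤ ⌊M⌋ := Int.floor_nonneg.2 hM
  have h3 : (J.card : ℤ) ≤ 2 * ⌊M⌋ + 1 := by omega
  have h4 : (J.card : ℝ) ≤ 2 * (⌊M⌋ : ℝ) + 1 := by exact_mod_cast h3
  linarith [Int.floor_le M]

/-- The frequency of times `j < n` with `shift j x ∈ staysPos` has constant mean by stationarity.
Since the walk is `o(n)` by the law of large numbers, its values at these times, all distinct, are
too few: the frequency tends to `0`, and dominated convergence concludes. -/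
theorem measure_staysPos_eq_zero (h : IsStepLaw ν) : stepsLaw ν staysPos = 0 := by
  classical
  set f : ℕ → (ℕ → ℤ) → ℝ := fun n x =>
    (∑ j ∈ Finset.range n, (shift j ⁻¹' staysPos).indicator (fun _ => (1 : ℝ)) x) / n
  have hcard : ∀ n x, f n x =
      (((Finset.range n).filter fun j => shift j x ∈ staysPos).card : ℝ) / n := by
    intro n x
    simp only [f, Set.indicator_apply, Set.mem_preimage, Finset.sum_boole]
  have hmeas : ∀ j, MeasurableSet (shift j ⁻¹' staysPos) := fun j =>
    measurable_shift j measurableSet_staysPos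
  have hint : ∀ n, 0 < n → ∫ x, f n x ∂stepsLaw ν = (stepsLaw ν).real staysPos := by
    intro n hn
    have hn' : (n : ℝ) ≠ 0 := by exact_mod_cast hn.ne'
    simp only [f]
    rw [integral_div, integral_finsetSum _ fun j _ =>
      (integrable_const (1 : ℝ)).indicator (hmeas j)]
    have : ∀ j ∈ Finset.range n,
        ∫ x, (shift j ⁻¹' staysPos).indicator (fun _ => (1 : ℝ)) x ∂stepsLaw ν =
          (stepsLaw ν).real staysPos := by
      intro j _
      rw [integral_indicator (hmeas j), setIntegral_const, smul_eq_mul, mul_one]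
      rw [← map_measureReal_apply (measurable_shift j) measurableSet_staysPos, map_shift]
    rw [Finset.sum_congr rfl this]
    simp [hn']
  have hlim : ∀ᵐ x ∂stepsLaw ν, Filter.Tendsto (fun n => f n x) Filter.atTop (nhds 0) := by
    filter_upwards [ae_tendsto_partialSum h] with x hx
    rw [Metric.tendsto_nhds]
    intro δ hδ
    obtain ⟨M, hM⟩ := exists_nat_gt (2 / δ)
    -- With `ε = δ / 4` the count is at most `δ * n / 2 + 1`, which is less than `δ * n` as soon as
    -- `n > 2 / δ`.
    filter_upwards [eventually_forall_le hx (ε := δ / 4) (by positivity),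
      Filter.eventually_ge_atTop M, Filter.eventually_gt_atTop 0] with n h1 h2 h3
    have h3' : (0 : ℝ) < n := by exact_mod_cast h3
    have h4 := card_le_of_abs_le (u := partialSum x) (M := δ / 4 * n)
      (J := (Finset.range n).filter fun j => shift j x ∈ staysPos) (by positivity)
      (fun j hj k hjk => lt_of_shift_mem_staysPos (Finset.mem_filter.1 hj).2 hjk)
      (fun j hj => h1 j (Finset.mem_range.1 (Finset.mem_filter.1 hj).1).le)
    rw [dist_zero_right, Real.norm_eq_abs, abs_of_nonneg (by rw [hcard]; positivity), hcard,
      div_lt_iff₀ h3']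
    have h5 : (2 : ℝ) / δ < n := hM.trans_le (by exact_mod_cast h2)
    rw [div_lt_iff₀ hδ] at h5
    linarith
  have htend := tendsto_integral_of_dominated_convergence (μ := stepsLaw ν) (F := f)
    (f := fun _ => 0) (fun _ => (1 : ℝ))
    (fun n => by
      refine Measurable.aestronglyMeasurable ?_
      refine Measurable.div_const (Finset.measurable_fun_sum _ fun j _ => ?_) _
      exact measurable_const.indicator (hmeas j))
    (integrable_const _)
    (fun n => Filter.Eventually.of_forall fun x => by
      rw [hcard, Real.norm_eq_abs, abs_of_nonneg (by positivity)]
      refine div_le_one_of_le₀ ?_ (by positivity)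
      exact_mod_cast (Finset.card_filter_le _ _).trans (by simp))
    hlim
  have hconst : Filter.Tendsto (fun n => ∫ x, f n x ∂stepsLaw ν) Filter.atTop
      (nhds ((stepsLaw ν).real staysPos)) := by
    refine tendsto_const_nhds.congr' ?_
    filter_upwards [Filter.eventually_gt_atTop 0] with n hn
    exact (hint n hn).symm
  have := tendsto_nhds_unique hconst htend
  rw [integral_zero, measureReal_eq_zero_iff] at this
  exact this

theorem ae_isGood (h : IsStepLaw ν) : ∀ᵐ x ∂stepsLaw ν, Coding.IsGood (partialSum x) := by
  have hmp : ∀ i, MeasurePreserving (fun x : ℕ → ℤ => x i) (stepsLaw ν) ν := fun i =>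
    measurePreserving_eval_infinitePi (fun _ : ℕ => ν) i
  have h1 : ∀ᵐ x ∂stepsLaw ν, ∀ n, x n ≤ 1 := by
    refine ae_all_iff.2 fun n => (hmp n).quasiMeasurePreserving.ae (p := fun k => k ≤ 1) ?_
    rw [ae_iff]
    simpa [Set.Ioi] using h.skipFree
  -- Prepending an up-step, of positive probability, turns a nonnegative walk into an element of
  -- `staysPos`.
  have h3 : stepsLaw ν staysNonneg = 0 := by
    have := measure_staysPos_eq_zero h
    rw [measure_staysPos, mul_eq_zero] at this
    exact this.resolve_left h.one_ne_zero
  have h4 : ∀ᵐ x ∂stepsLaw ν, ∀ j, shift j x ∉ staysNonneg := by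
    refine ae_all_iff.2 fun j => ?_
    rw [ae_iff]
    simp only [not_not]
    change stepsLaw ν (shift j ⁻¹' staysNonneg) = 0
    rw [← Measure.map_apply (measurable_shift j) measurableSet_staysNonneg, map_shift, h3]
  filter_upwards [h1, h4] with x hx1 hx4
  refine ⟨rfl, fun n => ?_, fun n => ?_⟩
  · rw [partialSum_succ]
    have := hx1 n
    omega
  · have := hx4 n
    simp only [staysNonneg, Set.mem_ofPred_eq, not_forall, not_le, partialSum_shift] at this
    obtain ⟨k, hk⟩ := this
    refine ⟨n + k, ?_, by omega⟩
    by_contra hk0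
    obtain rfl : k = 0 := by omega
    simp at hk

/-! ### Cylinders -/

theorem reads_partialSum_iff (x : ℕ → ℤ) (w : List ℤ) (n : ℕ) :
    Coding.Reads (partialSum x) n w ↔ ∀ i (hi : i < w.length), x (n + i) = w[i] := by
  induction w generalizing n with
  | nil => simp [Coding.Reads]
  | cons a w ih =>
    have h1 : (n : ℤ) + 1 = ((n + 1 : ℕ) : ℤ) := by push_cast; rfl
    rw [Coding.Reads, h1, ih, Coding.extend_natCast, Coding.extend_natCast, partialSum_succ,
      add_right_inj]
    constructor
    · rintro ⟨h2, h3⟩ i hi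
      cases i with
      | zero => exact h2
      | succ i =>
        have := h3 i (by simpa using hi)
        rw [show n + (i + 1) = n + 1 + i by omega, this]
        rfl
    · intro h2
      refine ⟨h2 0 (by simp), fun i hi => ?_⟩
      have := h2 (i + 1) (by simpa using hi)
      rw [show n + 1 + i = n + (i + 1) by omega, this]
      rfl

theorem measure_reads (w : List ℤ) :
    stepsLaw ν {x | Coding.Reads (partialSum x) 0 w} = (w.map fun k => ν {k}).prod := by
  have hset : {x | Coding.Reads (partialSum x) 0 w} =
      Set.pi (Finset.range w.length : Set ℕ) fun i => {w.getD i 0} := by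
    ext x
    have := reads_partialSum_iff x w 0
    rw [Nat.cast_zero] at this
    simp only [Set.mem_ofPred_eq, this, Set.mem_pi, Finset.mem_coe, Finset.mem_range,
      Set.mem_singleton_iff, zero_add]
    refine forall_congr' fun i => forall_congr' fun hi => ?_
    rw [List.getD_eq_getElem _ _ hi]
  rw [hset, stepsLaw, Measure.infinitePi_pi _ fun i _ => measurableSet_singleton _,
    Finset.prod_range, ← List.prod_ofFn]
  congr 1
  refine List.ext_getElem (by simp) fun i h1 h2 => ?_
  simp only [List.getElem_ofFn, List.getElem_map]
  rw [List.getD_eq_getElem]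

end Walk

/-! ## Kesten's tree -/

namespace PlaneTree

theorem unfold_append_singleton_mem {S : Type*} (kd : S → List S) (s : S) (w : List ℕ) (j : ℕ) :
    w ++ [j] ∈ (unfold kd s).verts ↔
      ∃ s', w.foldlM (fun s j => (kd s)[j]?) s = some s' ∧ j < (kd s').length := by
  simp only [unfold, Set.mem_ofPred_eq, List.foldlM_append]
  cases hw : w.foldlM (fun s j => (kd s)[j]?) s with
  | none => simp
  | some s' => simp

end PlaneTree

namespace Kesten

open CTree PlaneTree

theorem spine_succ (x : Sample) (n : ℕ) : spine x (n + 1) = spine x n ++ [(x.1 n).2] := by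
  simp [spine, List.range_succ]

@[simp] theorem length_spine (x : Sample) (n : ℕ) : (spine x n).length = n := by simp [spine]

theorem spine_getElem? (x : Sample) {n k : ℕ} (h : k < n) :
    (spine x n)[k]? = some (x.1 k).2 := by
  simp [spine, h]

theorem foldlM_tree (x : Sample) (w v : List ℕ) :
    w.foldlM (fun s j => ((List.range (degree x s)).map fun j => s ++ [j])[j]?) [] = some v →
      v = w := by
  induction w using List.reverseRecOn generalizing v with
  | nil => intro h; simpa using h.symm
  | append_singleton w j ih =>
    intro h
    rw [List.foldlM_append] at h
    obtain ⟨s, hs, h1⟩ := Option.bind_eq_some_iff.1 h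
    rw [ih s hs] at h1
    have h' : ∃ a, (List.range (degree x w))[j]? = some a ∧ w ++ [a] = v := by simpa using h1
    obtain ⟨a, ha, rfl⟩ := h'
    obtain ⟨h1, h2⟩ := List.getElem?_eq_some_iff.1 ha
    rw [← h2, List.getElem_range]

theorem append_singleton_mem_tree (x : Sample) (w : List ℕ) (j : ℕ) :
    w ++ [j] ∈ (tree x).verts ↔ w ∈ (tree x).verts ∧ j < degree x w := by
  rw [tree, unfold_append_singleton_mem]
  simp only [unfold, Set.mem_ofPred_eq, List.length_map, List.length_range]
  constructor
  · rintro ⟨s', h1, h2⟩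
    obtain rfl := foldlM_tree x w s' h1
    exact ⟨by rw [h1]; rfl, h2⟩
  · rintro ⟨h1, h2⟩
    obtain ⟨s', hs'⟩ := Option.isSome_iff_exists.1 h1
    obtain rfl := foldlM_tree x w s' hs'
    exact ⟨_, hs', h2⟩

theorem numChildren_tree (x : Sample) {w : List ℕ} (h : w ∈ (tree x).verts) :
    (tree x).numChildren w = degree x w := by
  have : {j : ℕ | w ++ [j] ∈ (tree x).verts} = Set.Iio (degree x w) := by
    ext j
    simp [append_singleton_mem_tree, h]
  rw [numChildren, this, Set.ncard_eq_toFinset_card', Set.toFinset_Iio, Nat.card_Iio]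

theorem numChildren_tree_of_notMem (x : Sample) {w : List ℕ} (h : w ∉ (tree x).verts) :
    (tree x).numChildren w = 0 := by
  have : {j : ℕ | w ++ [j] ∈ (tree x).verts} = ∅ := by
    ext j
    simp [append_singleton_mem_tree, h]
  rw [numChildren, this, Set.ncard_empty]

open Classical in
/-- The children of a vertex in the pruned tree. -/
noncomputable def prunedKids (x : Sample) (w : List ℕ) : List (List ℕ) :=
  ((List.range ((tree x).numChildren w)).map fun j => w ++ [j]).filter
    fun v => decide (¬ DiscardedLeft (spine x) v)

theorem pruneLeft_eq (x : Sample) :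
    (tree x).pruneLeft (spine x) = unfold (prunedKids x) [] := rfl

/-- The vertex `w` is at the right of the spine. -/
def IsRight (x : Sample) (w : List ℕ) : Prop :=
  ∃ n j r, w = spine x n ++ j :: r ∧ (x.1 n).2 < j

theorem IsRight.append {x : Sample} {w : List ℕ} (h : IsRight x w) (j : ℕ) :
    IsRight x (w ++ [j]) := by
  obtain ⟨n, i, r, rfl, hi⟩ := h
  exact ⟨n, i, r ++ [j], by simp, hi⟩

theorem IsRight.getElem? {x : Sample} {w : List ℕ} (h : IsRight x w) :
    ∃ n, (∀ k < n, w[k]? = some (x.1 k).2) ∧ ∃ j, w[n]? = some j ∧ (x.1 n).2 < j := by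
  obtain ⟨n, i, r, rfl, hi⟩ := h
  refine ⟨n, fun k hk => ?_, i, ?_, hi⟩
  · rw [List.getElem?_append_left (by simpa using hk), spine_getElem? x hk]
  · rw [List.getElem?_append_right (by simp)]
    simp

theorem DiscardedLeft.getElem? {x : Sample} {w : List ℕ} (h : DiscardedLeft (spine x) w) :
    ∃ n, (∀ k < n, w[k]? = some (x.1 k).2) ∧ ∃ j, w[n]? = some j ∧ j < (x.1 n).2 ∧
      ¬ (Odd n ∧ w.length = n + 1) := by
  obtain ⟨n, j, u, r, rfl, hu, hj, hr⟩ := h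
  rw [spine_succ] at hu
  obtain rfl : (x.1 n).2 = u := by simpa using hu
  refine ⟨n, fun k hk => ?_, j, ?_, hj, ?_⟩
  · rw [List.getElem?_append_left (by simpa using hk), spine_getElem? x hk]
  · rw [List.getElem?_append_right (by simp)]
    simp
  · rintro ⟨h1, h2⟩
    refine hr ⟨h1, ?_⟩
    simp only [List.length_append, length_spine, List.length_cons] at h2
    exact List.length_eq_zero_iff.1 (by omega)

/-- The two words are compared with the spine at the first letter where they leave it: this letter
is larger for one and smaller for the other. -/
theorem IsRight.not_discardedLeft {x : Sample} {w : List ℕ} (h : IsRight x w) :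
    ¬ DiscardedLeft (spine x) w := by
  intro hd
  obtain ⟨n, h1, j, h2, h3⟩ := h.getElem?
  obtain ⟨m, h4, i, h5, h6, -⟩ := DiscardedLeft.getElem? hd
  rcases lt_trichotomy n m with hnm | rfl | hnm
  · have := (h4 n hnm).symm.trans h2
    simp only [Option.some.injEq] at this
    omega
  · have := h5.symm.trans h2
    simp only [Option.some.injEq] at this
    omega
  · have := (h1 m hnm).symm.trans h5
    simp only [Option.some.injEq] at this
    omega

theorem IsRight.degree_eq {x : Sample} {w : List ℕ} (h : IsRight x w) : degree x w = x.2 w := by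
  rw [degree, if_neg]
  intro hw
  obtain ⟨n, -, j, h2, h3⟩ := h.getElem?
  have hn : n < w.length := (List.getElem?_eq_some_iff.1 h2).1
  rw [hw, spine_getElem? x hn, Option.some.injEq] at h2
  omega

/-- The children of the vertices which are not in the spine. -/
def freeKids (x : Sample) (w : List ℕ) : List (List ℕ) :=
  (List.range (x.2 w)).map fun j => w ++ [j]

theorem IsRight.prunedKids_eq {x : Sample} {w : List ℕ} (h : IsRight x w)
    (hw : w ∈ (tree x).verts) : prunedKids x w = freeKids x w := by
  rw [prunedKids, numChildren_tree x hw, h.degree_eq, freeKids, List.filter_eq_self]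
  intro v hv
  obtain ⟨j, -, rfl⟩ := List.mem_map.1 hv
  simpa using (h.append j).not_discardedLeft

/-- Pruning does not touch what is on the right of the spine, where the offspring numbers are the
free data. The generated forest is thus a function of these data alone. -/
theorem matchL_prunedKids {x : Sample} {t : CTree} {l : List (List ℕ)}
    (hl : ∀ w ∈ l, IsRight x w ∧ w ∈ (tree x).verts) (h : MatchL (freeKids x) l t) :
    MatchL (prunedKids x) l t := by
  induction t generalizing l with
  | nil => exact h
  | cons a t ih1 ih2 =>
    obtain ⟨s, l', rfl, h1, h2⟩ := h
    have hs := hl s (by simp)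
    refine ⟨s, l', rfl, ?_, ih2 (fun w hw => hl w (by simp [hw])) h2⟩
    rw [hs.1.prunedKids_eq hs.2]
    refine ih1 (fun w hw => ?_) h1
    obtain ⟨j, hj, rfl⟩ := List.mem_map.1 hw
    refine ⟨hs.1.append j, (append_singleton_mem_tree x s j).2 ⟨hs.2, ?_⟩⟩
    rw [hs.1.degree_eq]
    exact List.mem_range.1 hj

theorem degree_spine (x : Sample) (n : ℕ) : degree x (spine x n) = (x.1 n).1 := by
  simp [degree]

theorem discardedLeft_child_iff (x : Sample) (n j : ℕ) :
    DiscardedLeft (spine x) (spine x n ++ [j]) ↔ j < (x.1 n).2 ∧ Even n := by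
  constructor
  · intro h
    obtain ⟨m, h1, i, h2, h3, h4⟩ := DiscardedLeft.getElem? h
    have hm : m < n + 1 := by simpa using (List.getElem?_eq_some_iff.1 h2).1
    have hmn : m = n := by
      by_contra hne
      rw [List.getElem?_append_left (by simp; omega), spine_getElem? x (by omega),
        Option.some.injEq] at h2
      omega
    subst hmn
    rw [List.getElem?_append_right (by simp)] at h2
    simp only [length_spine, Nat.sub_self, List.getElem?_cons_zero, Option.some.injEq] at h2
    subst h2
    exact ⟨h3, by
      rw [← Nat.not_odd_iff_even]
      exact fun ho => h4 ⟨ho, by simp⟩⟩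
  · rintro ⟨h1, h2⟩
    exact ⟨n, j, _, [], rfl, spine_succ x n, h1, fun h => (Nat.not_odd_iff_even.2 h2) h.1⟩

/-- The children of a vertex of the spine on the right of the spine. -/
def rightKids (x : Sample) (n : ℕ) : List (List ℕ) :=
  (List.range ((x.1 n).1 - 1 - (x.1 n).2)).map fun j => spine x n ++ [(x.1 n).2 + 1 + j]

theorem range_map_spine (x : Sample) {n : ℕ} (h : (x.1 n).2 < (x.1 n).1) :
    (List.range (x.1 n).1).map (fun j => spine x n ++ [j]) =
      (List.range (x.1 n).2).map (fun j => spine x n ++ [j]) ++ spine x (n + 1) :: rightKids x n := by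
  have h1 : (x.1 n).1 = (x.1 n).2 + (1 + ((x.1 n).1 - 1 - (x.1 n).2)) := by omega
  conv_lhs => rw [h1]
  rw [List.range_add, List.map_append, List.map_map, List.range_add, List.map_append, List.map_map,
    rightKids, spine_succ]
  simp [Function.comp_def, add_assoc]

theorem mem_rightKids {x : Sample} {n : ℕ} (h : (x.1 n).2 < (x.1 n).1)
    (hn : spine x n ∈ (tree x).verts) {w : List ℕ} (hw : w ∈ rightKids x n) :
    IsRight x w ∧ w ∈ (tree x).verts := by
  obtain ⟨j, hj, rfl⟩ := List.mem_map.1 hw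
  rw [List.mem_range] at hj
  refine ⟨⟨n, _, [], rfl, by omega⟩, (append_singleton_mem_tree _ _ _).2 ⟨hn, ?_⟩⟩
  rw [degree_spine]
  omega

theorem prunedKids_spine_even {x : Sample} {n : ℕ} (h : (x.1 n).2 < (x.1 n).1)
    (hn : spine x n ∈ (tree x).verts) (he : Even n) :
    prunedKids x (spine x n) = spine x (n + 1) :: rightKids x n := by
  rw [prunedKids, numChildren_tree x hn, degree_spine, range_map_spine x h, List.filter_append,
    List.filter_eq_nil_iff.2, List.nil_append, List.filter_eq_self]
  · intro v hv
    rcases List.mem_cons.1 hv with rfl | hv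
    · rw [spine_succ]
      simp [discardedLeft_child_iff]
    · simpa using (mem_rightKids h hn hv).1.not_discardedLeft
  · intro v hv
    obtain ⟨j, hj, rfl⟩ := List.mem_map.1 hv
    simpa [discardedLeft_child_iff, he] using List.mem_range.1 hj

theorem prunedKids_spine_odd {x : Sample} {n : ℕ} (h : (x.1 n).2 < (x.1 n).1)
    (hn : spine x n ∈ (tree x).verts) (ho : Odd n) :
    prunedKids x (spine x n) = (List.range (x.1 n).2).map (fun j => spine x n ++ [j]) ++
      spine x (n + 1) :: rightKids x n := by
  rw [prunedKids, numChildren_tree x hn, degree_spine, ← range_map_spine x h, List.filter_eq_self]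
  intro v hv
  obtain ⟨j, hj, rfl⟩ := List.mem_map.1 hv
  simp [discardedLeft_child_iff, ho]

/-- A left child of a black spine vertex may survive, but its own children never do. These leaves
correspond to the singleton classes jumped over by the walk. -/
theorem prunedKids_left {x : Sample} {n j : ℕ} (h : j < (x.1 n).2) :
    prunedKids x (spine x n ++ [j]) = [] := by
  rw [prunedKids, List.filter_eq_nil_iff]
  intro v hv
  obtain ⟨i, -, rfl⟩ := List.mem_map.1 hv
  simp only [decide_eq_true_eq, not_not]
  exact ⟨n, j, _, [i], by simp, spine_succ x n, h, by simp⟩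

/-- The tree at height at least `2 n` is described by a finite sequence of blocks. -/
def Matches (x : Sample) : ℕ → List Block → Prop
  | _, [] => True
  | n, b :: d =>
    ((x.1 (2 * n)).2 < (x.1 (2 * n)).1 ∧ MatchL (freeKids x) (rightKids x (2 * n)) b.right) ∧
    (x.1 (2 * n + 1) = (b.above.len + b.k + 1, b.k) ∧
      MatchL (freeKids x) (rightKids x (2 * n + 1)) b.above) ∧
    Matches x (n + 1) d

theorem Matches.unique {x : Sample} {n : ℕ} {d d' : List Block} (h : Matches x n d)
    (h' : Matches x n d') (hl : d.length = d'.length) : d = d' := by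
  induction d generalizing n d' with
  | nil => exact (List.length_eq_zero_iff.1 hl.symm).symm
  | cons b d ih =>
    cases d' with
    | nil => simp at hl
    | cons b' d' =>
      obtain ⟨⟨-, h1⟩, ⟨h2, h3⟩, h4⟩ := h
      obtain ⟨⟨-, h1'⟩, ⟨h2', h3'⟩, h4'⟩ := h'
      rw [ih h4 h4' (by simpa using hl)]
      have e1 := h1.unique h1'
      have e3 := h3.unique h3'
      have e2 : b.k = b'.k := congrArg Prod.snd (h2.symm.trans h2')
      cases b
      cases b'
      simp_all

theorem agree_of_matches {x : Sample} {d : List Block} {n : ℕ} (h : Matches x n d)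
    (hn : spine x (2 * n) ∈ (tree x).verts) :
    Agree (prunedKids x) CTree.kids (2 * d.length) (spine x (2 * n)) (Block.toTree d) := by
  induction d generalizing n with
  | nil => trivial
  | cons b d ih =>
    obtain ⟨⟨h1, h2⟩, ⟨h3, h4⟩, h5⟩ := h
    have hlt : (x.1 (2 * n + 1)).2 < (x.1 (2 * n + 1)).1 := by rw [h3]; simp only; omega
    have hn1 : spine x (2 * n + 1) ∈ (tree x).verts := by
      rw [spine_succ, append_singleton_mem_tree, degree_spine]
      exact ⟨hn, h1⟩
    have hn2 : spine x (2 * n + 2) ∈ (tree x).verts := by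
      rw [spine_succ, append_singleton_mem_tree, degree_spine]
      exact ⟨hn1, hlt⟩
    have hm2 := matchL_prunedKids (fun w hw => mem_rightKids h1 hn hw) h2
    have hm4 := matchL_prunedKids (fun w hw => mem_rightKids hlt hn1 hw) h4
    have hih := ih h5 hn2
    rw [show 2 * (b :: d).length = 2 * d.length + 1 + 1 by simp; ring, Agree,
      prunedKids_spine_even h1 hn (even_two_mul n), Block.toTree, kids]
    refine List.Forall₂.cons ?_ (agree_of_matchL hm2 _)
    rw [Agree, prunedKids_spine_odd hlt hn1 (odd_two_mul_add_one n), kids_ofList]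
    refine List.rel_append ?_ (List.Forall₂.cons hih (agree_of_matchL hm4 _))
    rw [List.forall₂_iff_get]
    refine ⟨by simp [h3], fun i hi hi' => ?_⟩
    simp only [List.get_eq_getElem, List.getElem_map, List.getElem_range, List.getElem_replicate]
    exact Agree.of_matchL (t := .nil)
      (by rw [MatchL]; exact prunedKids_left (by simpa using hi)) _

theorem ball_pruneLeft {x : Sample} {d : List Block} (h : Matches x 0 d) {R : ℕ}
    (hR : R ≤ 2 * d.length) :
    ((tree x).pruneLeft (spine x)).ball R = (unfold CTree.kids (Block.toTree d)).ball R := by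
  rw [pruneLeft_eq]
  exact Agree.ball_eq ((agree_of_matches h (tree x).nil_mem).mono hR)

/-! ### Measurability -/

/-- The level sets of `f` are measurable. -/
def LevelMeasurable {X α : Type*} [MeasurableSpace X] (f : X → α) : Prop :=
  ∀ a, MeasurableSet {x | f x = a}

theorem LevelMeasurable.measurableSet {X α : Type*} [MeasurableSpace X] [Countable α] {f : X → α}
    (hf : LevelMeasurable f) (p : α → Prop) : MeasurableSet {x | p (f x)} := by
  have : {x | p (f x)} = ⋃ a : {a // p a}, {x | f x = a} := by
    ext x; simp
  rw [this]
  exact MeasurableSet.iUnion fun a => hf a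

/-- Splitting over the countably many values of `f` allows data-dependent constructions without a
σ-algebra on words or lists of words. -/
theorem LevelMeasurable.bind {X α β : Type*} [MeasurableSpace X] [Countable α] {f : X → α}
    (hf : LevelMeasurable f) {g : α → X → β} (hg : ∀ a, LevelMeasurable (g a)) :
    LevelMeasurable fun x => g (f x) x := by
  intro b
  have : {x | g (f x) x = b} = ⋃ a, {x | f x = a} ∩ {x | g a x = b} := by
    ext x; simp
  rw [this]
  exact MeasurableSet.iUnion fun a => (hf a).inter (hg a b)

theorem levelMeasurable_const {X α : Type*} [MeasurableSpace X] (a : α) :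
    LevelMeasurable fun _ : X => a := fun _ => MeasurableSet.const _

theorem LevelMeasurable.comp {X α β : Type*} [MeasurableSpace X] [Countable α] {f : X → α}
    (hf : LevelMeasurable f) (g : α → β) : LevelMeasurable fun x => g (f x) :=
  hf.bind fun a => levelMeasurable_const (g a)

theorem LevelMeasurable.of_measurable {X α : Type*} [MeasurableSpace X] [MeasurableSpace α]
    [MeasurableSingletonClass α] {f : X → α} (hf : Measurable f) : LevelMeasurable f :=
  fun a => hf (measurableSet_singleton a)

theorem levelMeasurable_filter {X α : Type*} [MeasurableSpace X] [Countable α] (p : X → α → Prop)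
    [∀ x, DecidablePred (p x)] (hp : ∀ a, MeasurableSet {x | p x a}) (l : List α) :
    LevelMeasurable fun x => l.filter fun a => decide (p x a) := by
  induction l with
  | nil => exact levelMeasurable_const _
  | cons a l ih =>
    intro b
    have : {x | (a :: l).filter (fun a => decide (p x a)) = b} =
        ({x | p x a} ∩ {x | a :: l.filter (fun a => decide (p x a)) = b}) ∪
          ({x | p x a}ᶜ ∩ {x | l.filter (fun a => decide (p x a)) = b}) := by
      ext x
      by_cases h : p x a <;> simp [h]
    rw [this]
    exact ((hp a).inter (ih.comp (List.cons a) b)).union ((hp a).compl.inter (ih b))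

theorem levelMeasurable_spineData (n : ℕ) : LevelMeasurable fun x : Sample => x.1 n :=
  .of_measurable ((measurable_pi_apply n).comp measurable_fst)

theorem levelMeasurable_freeData (w : List ℕ) : LevelMeasurable fun x : Sample => x.2 w :=
  .of_measurable ((measurable_pi_apply w).comp measurable_snd)

theorem levelMeasurable_spine (n : ℕ) : LevelMeasurable fun x : Sample => spine x n := by
  induction n with
  | zero => exact levelMeasurable_const _
  | succ n ih =>
    simp only [spine_succ]
    exact ih.bind (g := fun s x => s ++ [(x.1 n).2]) fun s =>
      (levelMeasurable_spineData n).comp fun p => s ++ [p.2]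

theorem levelMeasurable_degree (w : List ℕ) : LevelMeasurable fun x : Sample => degree x w := by
  refine (levelMeasurable_spine w.length).bind
    (g := fun s x => if w = s then (x.1 w.length).1 else x.2 w) fun s => ?_
  split_ifs
  · exact (levelMeasurable_spineData w.length).comp Prod.fst
  · exact levelMeasurable_freeData w

theorem measurableSet_mem_tree (w : List ℕ) : MeasurableSet {x : Sample | w ∈ (tree x).verts} := by
  induction w using List.reverseRecOn with
  | nil => simp [(tree _).nil_mem]
  | append_singleton w j ih =>
    simp only [append_singleton_mem_tree]
    exact ih.inter ((levelMeasurable_degree w).measurableSet fun k => j < k)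

theorem levelMeasurable_numChildren (w : List ℕ) :
    LevelMeasurable fun x : Sample => (tree x).numChildren w := by
  intro k
  have : {x : Sample | (tree x).numChildren w = k} =
      ({x | w ∈ (tree x).verts} ∩ {x | degree x w = k}) ∪
        ({x | w ∈ (tree x).verts}ᶜ ∩ {_x | 0 = k}) := by
    ext x
    by_cases h : w ∈ (tree x).verts
    · simp [h, numChildren_tree x h]
    · simp [h, numChildren_tree_of_notMem x h]
  rw [this]
  have hw := measurableSet_mem_tree w
  exact (hw.inter (levelMeasurable_degree w k)).union (hw.compl.inter (MeasurableSet.const _))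

theorem measurableSet_discardedLeft (v : List ℕ) :
    MeasurableSet {x : Sample | DiscardedLeft (spine x) v} := by
  have : {x : Sample | DiscardedLeft (spine x) v} =
      ⋃ (n : ℕ) (j : ℕ) (u : ℕ) (r : List ℕ), {x : Sample | v = spine x n ++ j :: r} ∩
        ({x : Sample | ∃ s, s = spine x n ∧ spine x (n + 1) = s ++ [u]} ∩
          {_x : Sample | j < u ∧ ¬ (Odd n ∧ r = [])}) := by
    ext x
    simp only [DiscardedLeft, Set.mem_ofPred_eq, Set.mem_iUnion, Set.mem_inter_iff, exists_eq_left]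
  rw [this]
  refine .iUnion fun n => .iUnion fun j => .iUnion fun u => .iUnion fun r => ?_
  refine ((levelMeasurable_spine n).measurableSet fun s => v = s ++ j :: r).inter
    (MeasurableSet.inter ?_ (.const _))
  have : {x : Sample | ∃ s, s = spine x n ∧ spine x (n + 1) = s ++ [u]} =
      ⋃ s : List ℕ, {x | spine x n = s} ∩ {x | spine x (n + 1) = s ++ [u]} := by
    ext x; simp
  rw [this]
  exact .iUnion fun s => (levelMeasurable_spine n s).inter (levelMeasurable_spine (n + 1) _)

theorem levelMeasurable_prunedKids (w : List ℕ) :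
    LevelMeasurable fun x : Sample => prunedKids x w := by
  classical
  refine (levelMeasurable_numChildren w).bind (g := fun k x =>
    ((List.range k).map fun j => w ++ [j]).filter
      fun v => decide (¬ DiscardedLeft (spine x) v)) fun k => ?_
  exact levelMeasurable_filter (fun x v => ¬ DiscardedLeft (spine x) v)
    (fun v => (measurableSet_discardedLeft v).compl) _

theorem levelMeasurable_foldlM {X S : Type*} [MeasurableSpace X] [Countable S]
    {kd : X → S → List S} (h : ∀ s, LevelMeasurable fun x => kd x s) (s : S) (w : List ℕ) :
    LevelMeasurable fun x => w.foldlM (fun s j => (kd x s)[j]?) s := by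
  induction w using List.reverseRecOn with
  | nil => exact levelMeasurable_const _
  | append_singleton w j ih =>
    simp only [List.foldlM_append, List.foldlM_cons, List.foldlM_nil]
    refine ih.bind (g := fun o x => o.bind fun s => ((kd x s)[j]?).bind fun s' => some s')
      fun o => ?_
    cases o with
    | none => exact levelMeasurable_const _
    | some s => exact (h s).comp fun l => (l[j]?).bind fun s' => some s'

end Kesten

theorem PlaneTree.measurable_of_measurableSet_mem {X : Type*} [MeasurableSpace X]
    {f : X → PlaneTree} (h : ∀ w, MeasurableSet {x | w ∈ (f x).verts}) : Measurable f := by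
  refine measurable_generateFrom ?_
  rintro _ ⟨s, R, rfl⟩
  have : f ⁻¹' {t | t.ball R = s.ball R} =
      ⋂ w : List ℕ, {x | w.length ≤ R → (w ∈ (f x).verts ↔ w ∈ s.verts)} := by
    ext x
    simp only [Set.mem_preimage, Set.mem_ofPred_eq, Set.mem_iInter, Set.ext_iff, PlaneTree.ball]
    exact forall_congr' fun w => by tauto
  rw [this]
  refine MeasurableSet.iInter fun w => ?_
  by_cases hR : w.length ≤ R
  · by_cases hs : w ∈ s.verts
    · simpa [hR, hs] using h w
    · convert (h w).compl using 1
      ext x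
      simp [hR, hs]
  · simp [hR]

theorem Kesten.measurable_pruneLeft :
    Measurable fun x : Sample => (tree x).pruneLeft (spine x) := by
  refine PlaneTree.measurable_of_measurableSet_mem fun w => ?_
  exact (levelMeasurable_foldlM levelMeasurable_prunedKids [] w).measurableSet
    fun o => o.isSome = true

/-! ## The law of Kesten's tree -/

namespace Kesten

open CTree

/-- The children `v ++ [0], …, v ++ [k - 1]` of a word. -/
def children (v : List ℕ) (k : ℕ) : List (List ℕ) := (List.range k).map fun j => v ++ [j]

/-- The numbers of children prescribed at the vertices of the trees `t.kids`, planted at the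
vertices in the list `l`. -/
def constraints : List (List ℕ) → CTree → List (List ℕ × ℕ)
  | _, nil => []
  | [], cons _ _ => []
  | v :: l, cons h t => (v, h.len) :: (constraints (children v h.len) h ++ constraints l t)

/-- It turns the generation of a given forest into finitely many equations on coordinates, to which
independence applies. -/
theorem matchL_freeKids_iff (x : Sample) (l : List (List ℕ)) (t : CTree) :
    MatchL (freeKids x) l t ↔ l.length = t.len ∧ ∀ c ∈ constraints l t, x.2 c.1 = c.2 := by
  induction t generalizing l with
  | nil => simp [MatchL, constraints, len, List.length_eq_zero_iff]
  | cons h t ih1 ih2 =>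
    cases l with
    | nil => simp [MatchL, len]
    | cons v l =>
      have hch : ∀ k, x.2 v = k → freeKids x v = children v k := by rintro k rfl; rfl
      constructor
      · rintro ⟨s, l', he, h1, h2⟩
        obtain ⟨rfl, rfl⟩ := List.cons.inj he
        have hv : x.2 v = h.len := by simpa [freeKids] using h1.length_eq
        rw [hch _ hv, ih1] at h1
        rw [ih2] at h2
        refine ⟨by simp [len, h2.1], fun c hc => ?_⟩
        simp only [constraints, List.mem_cons, List.mem_append] at hc
        rcases hc with rfl | hc | hc
        · exact hv
        · exact h1.2 c hc
        · exact h2.2 c hc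
      · rintro ⟨h1, h2⟩
        simp only [constraints, List.mem_cons, List.mem_append] at h2
        have hv : x.2 v = h.len := h2 (v, h.len) (Or.inl rfl)
        refine ⟨v, l, rfl, ?_, ?_⟩
        · rw [hch _ hv, ih1]
          exact ⟨by simp [children], fun c hc => h2 c (Or.inr (Or.inl hc))⟩
        · rw [ih2]
          exact ⟨by simpa [len] using h1, fun c hc => h2 c (Or.inr (Or.inr hc))⟩

/-- Neither word is a prefix of the other one. -/
def Incomparable (v w : List ℕ) : Prop := ¬ v <+: w ∧ ¬ w <+: v

theorem pairwise_children (v : List ℕ) (k : ℕ) : (children v k).Pairwise Incomparable := by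
  rw [children, List.pairwise_map]
  refine List.nodup_range.imp fun {i j} hij => ?_
  constructor
  · intro h
    exact hij (by simpa using h.eq_of_length (by simp))
  · intro h
    exact hij (by simpa using (h.eq_of_length (by simp)).symm)

theorem exists_prefix_of_mem_constraints {l : List (List ℕ)} {t : CTree} {c : List ℕ × ℕ}
    (hc : c ∈ constraints l t) : ∃ v ∈ l, v <+: c.1 := by
  induction t generalizing l with
  | nil => simp [constraints] at hc
  | cons h t ih1 ih2 =>
    cases l with
    | nil => simp [constraints] at hc
    | cons v l =>
      simp only [constraints, List.mem_cons, List.mem_append] at hc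
      rcases hc with rfl | hc | hc
      · exact ⟨v, by simp, List.prefix_rfl⟩
      · obtain ⟨u, hu, huc⟩ := ih1 hc
        obtain ⟨j, -, rfl⟩ := List.mem_map.1 hu
        exact ⟨v, by simp, (List.prefix_append v [j]).trans huc⟩
      · obtain ⟨u, hu, huc⟩ := ih2 hc
        exact ⟨u, by simp [hu], huc⟩

/-- Subtrees planted at incomparable words involve disjoint sets of coordinates, which is what the
product formula requires. -/
theorem nodup_constraints {l : List (List ℕ)} (hl : l.Pairwise Incomparable) (t : CTree) :
    ((constraints l t).map Prod.fst).Nodup := by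
  induction t generalizing l with
  | nil => simp [constraints]
  | cons h t ih1 ih2 =>
    cases l with
    | nil => simp [constraints]
    | cons v l =>
      rw [List.pairwise_cons] at hl
      have hpre : ∀ c ∈ constraints (children v h.len) h, ∃ j, v ++ [j] <+: c.1 := by
        intro c hc
        obtain ⟨u, hu, huc⟩ := exists_prefix_of_mem_constraints hc
        obtain ⟨j, -, rfl⟩ := List.mem_map.1 hu
        exact ⟨j, huc⟩
      simp only [constraints, List.map_cons, List.map_append]
      refine List.nodup_cons.2 ⟨?_, List.nodup_append.2 ⟨ih1 (pairwise_children _ _), ih2 hl.2, ?_⟩⟩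
      · rw [List.mem_append, not_or]
        constructor
        · intro hm
          obtain ⟨c, hc, hcv⟩ := List.mem_map.1 hm
          obtain ⟨j, hj⟩ := hpre c hc
          rw [hcv] at hj
          simpa using hj.length_le
        · intro hm
          obtain ⟨c, hc, hcv⟩ := List.mem_map.1 hm
          obtain ⟨u, hu, huc⟩ := exists_prefix_of_mem_constraints hc
          rw [hcv] at huc
          exact (hl.1 u hu).2 huc
      · intro w hw w' hw' hww'
        subst hww'
        obtain ⟨c, hc, rfl⟩ := List.mem_map.1 hw
        obtain ⟨c', hc', hcc⟩ := List.mem_map.1 hw'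
        obtain ⟨j, hj⟩ := hpre c hc
        obtain ⟨u, hu, huc⟩ := exists_prefix_of_mem_constraints hc'
        rw [hcc] at huc
        have hv := (List.prefix_append v [j]).trans hj
        rcases List.prefix_or_prefix_of_prefix hv huc with h1 | h1
        · exact (hl.1 u hu).1 h1
        · exact (hl.1 u hu).2 h1

/-- The word `w` leaves the spine at height `m`, on the right. -/
def Branches (x : Sample) (m : ℕ) (w : List ℕ) : Prop :=
  (∀ k < m, w[k]? = some (x.1 k).2) ∧ ∃ j, w[m]? = some j ∧ (x.1 m).2 < j

theorem Branches.unique {x : Sample} {m m' : ℕ} {w : List ℕ} (h : Branches x m w)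
    (h' : Branches x m' w) : m = m' := by
  obtain ⟨h1, j, h2, h3⟩ := h
  obtain ⟨h1', j', h2', h3'⟩ := h'
  rcases lt_trichotomy m m' with hm | hm | hm
  · have := (h1' m hm).symm.trans h2
    simp only [Option.some.injEq] at this
    omega
  · exact hm
  · have := (h1 m' hm).symm.trans h2'
    simp only [Option.some.injEq] at this
    omega

theorem branches_of_mem_constraints {x : Sample} {m : ℕ} {t : CTree} {c : List ℕ × ℕ}
    (hc : c ∈ constraints (rightKids x m) t) : Branches x m c.1 := by
  obtain ⟨v, hv, r, hr⟩ := exists_prefix_of_mem_constraints hc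
  obtain ⟨j, -, rfl⟩ := List.mem_map.1 hv
  rw [← hr, List.append_assoc]
  refine ⟨fun k hk => ?_, (x.1 m).2 + 1 + j, ?_, by omega⟩
  · rw [List.getElem?_append_left (by simpa using hk), spine_getElem? x hk]
  · rw [List.getElem?_append_right (by simp)]
    simp

theorem pairwise_rightKids (x : Sample) (m : ℕ) : (rightKids x m).Pairwise Incomparable := by
  rw [rightKids, List.pairwise_map]
  refine List.nodup_range.imp fun {i j} hij => ?_
  constructor
  · intro h
    exact hij (by simpa using h.eq_of_length (by simp))
  · intro h
    exact hij (by simpa using (h.eq_of_length (by simp)).symm)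

/-- All the numbers of children prescribed out of the spine by a finite sequence of blocks. -/
def blockConstraints (x : Sample) : ℕ → List Block → List (List ℕ × ℕ)
  | _, [] => []
  | n, b :: d => constraints (rightKids x (2 * n)) b.right ++
      (constraints (rightKids x (2 * n + 1)) b.above ++ blockConstraints x (n + 1) d)

theorem branches_of_mem_blockConstraints {x : Sample} {n : ℕ} {d : List Block} {c : List ℕ × ℕ}
    (hc : c ∈ blockConstraints x n d) : ∃ m, 2 * n ≤ m ∧ Branches x m c.1 := by
  induction d generalizing n with
  | nil => simp [blockConstraints] at hc
  | cons b d ih =>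
    simp only [blockConstraints, List.mem_append] at hc
    rcases hc with hc | hc | hc
    · exact ⟨_, le_rfl, branches_of_mem_constraints hc⟩
    · exact ⟨_, by omega, branches_of_mem_constraints hc⟩
    · obtain ⟨m, hm, h⟩ := ih hc
      exact ⟨m, by omega, h⟩

/-- Words prescribed by different spine vertices leave the spine at different heights, so they are
distinct. -/
theorem nodup_blockConstraints (x : Sample) (n : ℕ) (d : List Block) :
    ((blockConstraints x n d).map Prod.fst).Nodup := by
  induction d generalizing n with
  | nil => simp [blockConstraints]
  | cons b d ih =>
    simp only [blockConstraints, List.map_append]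
    refine List.nodup_append.2 ⟨nodup_constraints (pairwise_rightKids x _) _,
      List.nodup_append.2 ⟨nodup_constraints (pairwise_rightKids x _) _, ih _, ?_⟩, ?_⟩
    · intro w hw w' hw' hww'
      subst hww'
      obtain ⟨c, hc, rfl⟩ := List.mem_map.1 hw
      obtain ⟨c', hc', hcc⟩ := List.mem_map.1 hw'
      obtain ⟨m, hm, h⟩ := branches_of_mem_blockConstraints hc'
      rw [hcc] at h
      have := (branches_of_mem_constraints hc).unique h
      omega
    · intro w hw w' hw' hww'
      subst hww'
      obtain ⟨c, hc, rfl⟩ := List.mem_map.1 hw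
      rw [List.mem_append] at hw'
      rcases hw' with hw' | hw'
      · obtain ⟨c', hc', hcc⟩ := List.mem_map.1 hw'
        have h := branches_of_mem_constraints hc'
        rw [hcc] at h
        have := (branches_of_mem_constraints hc).unique h
        omega
      · obtain ⟨c', hc', hcc⟩ := List.mem_map.1 hw'
        obtain ⟨m, hm, h⟩ := branches_of_mem_blockConstraints hc'
        rw [hcc] at h
        have := (branches_of_mem_constraints hc).unique h
        omega

/-- The sets of values of the data at a white and a black vertex of the spine which are compatible
with a block. -/
def spineSets (b : Block) : List (Set (ℕ × ℕ)) :=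
  [{p | p.2 < p.1 ∧ p.1 - 1 - p.2 = b.right.len}, {(b.above.len + b.k + 1, b.k)}]

theorem matches_iff (x : Sample) (n : ℕ) (d : List Block) :
    Matches x n d ↔
      (∀ i (hi : i < (d.flatMap spineSets).length), x.1 (2 * n + i) ∈ (d.flatMap spineSets)[i]) ∧
      ∀ c ∈ blockConstraints x n d, x.2 c.1 = c.2 := by
  induction d generalizing n with
  | nil => simp [Matches, blockConstraints]
  | cons b d ih =>
    have hsets : (∀ i (hi : i < ((b :: d).flatMap spineSets).length),
        x.1 (2 * n + i) ∈ ((b :: d).flatMap spineSets)[i]) ↔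
        ((x.1 (2 * n)).2 < (x.1 (2 * n)).1 ∧
          (x.1 (2 * n)).1 - 1 - (x.1 (2 * n)).2 = b.right.len) ∧
        x.1 (2 * n + 1) = (b.above.len + b.k + 1, b.k) ∧
        (∀ i (hi : i < (d.flatMap spineSets).length),
          x.1 (2 * (n + 1) + i) ∈ (d.flatMap spineSets)[i]) := by
      have hcons : (b :: d).flatMap spineSets =
          {p | p.2 < p.1 ∧ p.1 - 1 - p.2 = b.right.len} ::
            {(b.above.len + b.k + 1, b.k)} :: d.flatMap spineSets := rfl
      simp only [hcons]
      constructor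
      · intro h
        refine ⟨h 0 (by simp), h 1 (by simp), fun i hi => ?_⟩
        have := h (i + 2) (by simpa using hi)
        rwa [show 2 * n + (i + 2) = 2 * (n + 1) + i by ring] at this
      · rintro ⟨h1, h2, h3⟩ i hi
        match i, hi with
        | 0, _ => exact h1
        | 1, _ => exact h2
        | i + 2, hi =>
          have := h3 i (by simpa using hi)
          rwa [show 2 * (n + 1) + i = 2 * n + (i + 2) by ring] at this
    rw [hsets, Matches, ih, matchL_freeKids_iff, matchL_freeKids_iff, blockConstraints]
    have hlen : ∀ m, (rightKids x m).length = (x.1 m).1 - 1 - (x.1 m).2 := by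
      intro m; simp [rightKids]
    rw [hlen, hlen]
    simp only [List.mem_append]
    constructor
    · rintro ⟨⟨h1, h2, h3⟩, ⟨h4, h5, h6⟩, h7, h8⟩
      refine ⟨⟨⟨h1, h2⟩, h4, h7⟩, fun c hc => ?_⟩
      rcases hc with hc | hc | hc
      exacts [h3 c hc, h6 c hc, h8 c hc]
    · rintro ⟨⟨⟨h1, h2⟩, h4, h7⟩, h⟩
      refine ⟨⟨h1, h2, fun c hc => h c (Or.inl hc)⟩,
        ⟨h4, by rw [h4]; simp only; omega, fun c hc => h c (Or.inr (Or.inl hc))⟩, h7,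
        fun c hc => h c (Or.inr (Or.inr hc))⟩

/-! ### Probabilities -/

theorem infinitePi_constraints {ι : Type*} (μ : ι → PMF ℕ) {L : List (ι × ℕ)}
    (hL : (L.map Prod.fst).Nodup) :
    Measure.infinitePi (fun i => (μ i).toMeasure) {y | ∀ c ∈ L, y c.1 = c.2} =
      (L.map fun c => μ c.1 c.2).prod := by
  classical
  have hinj : ∀ c ∈ L, ∀ c' ∈ L, c.1 = c'.1 → c = c' := List.inj_on_of_nodup_map hL
  have hset : {y : ι → ℕ | ∀ c ∈ L, y c.1 = c.2} =
      Set.pi ((L.map Prod.fst).toFinset : Set ι) fun i => {k | ∀ c ∈ L, c.1 = i → k = c.2} := by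
    ext y
    simp only [Set.mem_ofPred_eq, Set.mem_pi, List.coe_toFinset]
    constructor
    · rintro h i - c hc rfl
      exact h c hc
    · intro h c hc
      exact h c.1 (List.mem_map_of_mem hc) c hc rfl
  rw [hset, Measure.infinitePi_pi _ fun i _ => MeasurableSet.of_discrete,
    List.prod_toFinset _ hL, List.map_map]
  congr 1
  refine List.map_congr_left fun c hc => ?_
  have : {k | ∀ c' ∈ L, c'.1 = c.1 → k = c'.2} = {c.2} := by
    ext k
    simp only [Set.mem_ofPred_eq, Set.mem_singleton_iff]
    refine ⟨fun h => h c hc rfl, ?_⟩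
    rintro rfl c' hc' he
    rw [hinj c' hc' c hc he]
  rw [Function.comp_apply, this, PMF.toMeasure_apply_singleton _ _ (measurableSet_singleton _)]

/-- The product of the measures of the sets in a list, starting at a given index. -/
noncomputable def listProd {α : Type*} [MeasurableSpace α] (μ : ℕ → Measure α) :
    ℕ → List (Set α) → ℝ≥0∞
  | _, [] => 1
  | n, s :: L => μ n s * listProd μ (n + 1) L

theorem infinitePi_list {α : Type*} [MeasurableSpace α] [DiscreteMeasurableSpace α]
    (μ : ℕ → Measure α) [∀ n, IsProbabilityMeasure (μ n)] (L : List (Set α)) :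
    Measure.infinitePi μ {y | ∀ i (hi : i < L.length), y i ∈ L[i]} = listProd μ 0 L := by
  have hset : {y : ℕ → α | ∀ i (hi : i < L.length), y i ∈ L[i]} =
      Set.pi (Finset.range L.length : Set ℕ) fun i => L.getD i Set.univ := by
    ext y
    simp only [Set.mem_ofPred_eq, Set.mem_pi, Finset.mem_coe, Finset.mem_range]
    refine forall_congr' fun i => forall_congr' fun hi => ?_
    rw [List.getD_eq_getElem _ _ hi]
  rw [hset, Measure.infinitePi_pi _ fun i _ => MeasurableSet.of_discrete]
  clear hset
  have key : ∀ n, ∏ i ∈ Finset.range L.length, μ (n + i) (L.getD i Set.univ) = listProd μ n L := by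
    induction L with
    | nil => intro n; rfl
    | cons s L ih =>
      intro n
      rw [listProd, ← ih (n + 1), List.length_cons, Finset.prod_range_succ', mul_comm]
      refine congrArg₂ _ rfl (Finset.prod_congr rfl fun i _ => ?_)
      rw [show n + (i + 1) = n + 1 + i by ring]
      rfl
  simpa using key 0

/-- The weight of the trees in `t.kids`, planted at height `n`. -/
noncomputable def forestWeight (p q : PMF ℕ) : ℕ → CTree → ℝ≥0∞
  | _, nil => 1
  | n, cons h t => offspring p q n h.len * (forestWeight p q (n + 1) h * forestWeight p q n t)

theorem prod_constraints (p q : PMF ℕ) {l : List (List ℕ)} {t : CTree} {n : ℕ}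
    (hl : ∀ v ∈ l, v.length = n) (hlen : l.length = t.len) :
    ((constraints l t).map fun c => offspring p q c.1.length c.2).prod = forestWeight p q n t := by
  induction t generalizing l n with
  | nil => simp [constraints, forestWeight]
  | cons h t ih1 ih2 =>
    cases l with
    | nil => simp [len] at hlen
    | cons v l =>
      rw [constraints, List.map_cons, List.prod_cons, List.map_append, List.prod_append,
        ih1 (l := children v h.len) (n := n + 1), ih2 (l := l) (n := n), forestWeight,
        hl v (by simp)]
      · exact fun w hw => hl w (by simp [hw])
      · simpa [len] using hlen
      · intro w hw
        obtain ⟨j, -, rfl⟩ := List.mem_map.1 hw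
        simp [hl v (by simp)]
      · simp [children]

/-- The weight of the part of the tree out of the spine. -/
noncomputable def blocksWeight (p q : PMF ℕ) (d : List Block) : ℝ≥0∞ :=
  (d.map fun b => forestWeight p q 1 b.right * forestWeight p q 0 b.above).prod

theorem offspring_even (p q : PMF ℕ) {n : ℕ} (h : Even n) : offspring p q n = p := if_pos h

theorem offspring_odd (p q : PMF ℕ) {n : ℕ} (h : Odd n) : offspring p q n = q :=
  if_neg (Nat.not_even_iff_odd.2 h)

theorem forestWeight_add_two (p q : PMF ℕ) (n : ℕ) (t : CTree) :
    forestWeight p q (n + 2) t = forestWeight p q n t := by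
  induction t generalizing n with
  | nil => rfl
  | cons h t ih1 ih2 =>
    rw [forestWeight, forestWeight, ih2, show n + 2 + 1 = n + 1 + 2 by ring, ih1, offspring,
      offspring]
    simp [parity_simps]

theorem forestWeight_add_two_mul (p q : PMF ℕ) (n m : ℕ) (t : CTree) :
    forestWeight p q (2 * n + m) t = forestWeight p q m t := by
  induction n with
  | zero => simp
  | succ n ih => rw [show 2 * (n + 1) + m = 2 * n + m + 2 by ring, forestWeight_add_two, ih]

/-- The constrained words move with the spine, but their offspring laws depend only on the parity of
their height. The product is therefore the same for all compatible spines. -/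
theorem prod_blockConstraints (p q : PMF ℕ) {x : Sample} {n : ℕ} {d : List Block}
    (h : ∀ i (hi : i < (d.flatMap spineSets).length), x.1 (2 * n + i) ∈ (d.flatMap spineSets)[i]) :
    ((blockConstraints x n d).map fun c => offspring p q c.1.length c.2).prod =
      blocksWeight p q d := by
  induction d generalizing n with
  | nil => simp [blockConstraints, blocksWeight]
  | cons b d ih =>
    have hcons : (b :: d).flatMap spineSets =
        {p | p.2 < p.1 ∧ p.1 - 1 - p.2 = b.right.len} ::
          {(b.above.len + b.k + 1, b.k)} :: d.flatMap spineSets := rfl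
    simp only [hcons] at h
    have h0 : (x.1 (2 * n)).1 - 1 - (x.1 (2 * n)).2 = b.right.len := (h 0 (by simp)).2
    have h1 : x.1 (2 * n + 1) = (b.above.len + b.k + 1, b.k) := h 1 (by simp)
    have hlen : ∀ m, ∀ v ∈ rightKids x m, v.length = m + 1 := by
      intro m v hv
      obtain ⟨j, -, rfl⟩ := List.mem_map.1 hv
      simp
    rw [blockConstraints, List.map_append, List.prod_append, List.map_append, List.prod_append,
      ih fun i hi => by
        have := h (i + 2) (by simpa using hi)
        rwa [show 2 * n + (i + 2) = 2 * (n + 1) + i by ring] at this,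
      prod_constraints p q (hlen _) (by simpa [rightKids] using h0),
      prod_constraints p q (hlen _) (by simp [rightKids, h1]), blocksWeight, blocksWeight,
      List.map_cons, List.prod_cons, forestWeight_add_two_mul,
      show 2 * n + 1 + 1 = 2 * (n + 1) + 0 by ring, forestWeight_add_two_mul, mul_assoc]

theorem levelMeasurable_rightKids (n : ℕ) : LevelMeasurable fun x : Sample => rightKids x n :=
  (levelMeasurable_spine n).bind
    (g := fun s x => (List.range ((x.1 n).1 - 1 - (x.1 n).2)).map fun j => s ++ [(x.1 n).2 + 1 + j])
    fun s => (levelMeasurable_spineData n).comp fun p =>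
      (List.range (p.1 - 1 - p.2)).map fun j => s ++ [p.2 + 1 + j]

theorem measurableSet_matchL (n : ℕ) (t : CTree) :
    MeasurableSet {x : Sample | MatchL (freeKids x) (rightKids x n) t} := by
  have : {x : Sample | MatchL (freeKids x) (rightKids x n) t} = ⋃ l : List (List ℕ),
      {x | rightKids x n = l} ∩ ({_x | l.length = t.len} ∩
        ⋂ c : {c // c ∈ constraints l t}, {x | x.2 c.1.1 = c.1.2}) := by
    ext x
    simp only [Set.mem_ofPred_eq, matchL_freeKids_iff, Set.mem_iUnion, Set.mem_inter_iff,
      Set.mem_iInter, Subtype.forall, exists_eq_left']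
  rw [this]
  exact .iUnion fun l => (levelMeasurable_rightKids n l).inter
    ((MeasurableSet.const _).inter (.iInter fun c => levelMeasurable_freeData _ _))

theorem measurableSet_matches (n : ℕ) (d : List Block) :
    MeasurableSet {x : Sample | Matches x n d} := by
  induction d generalizing n with
  | nil => simp [Matches]
  | cons b d ih =>
    simp only [Matches]
    refine MeasurableSet.inter (MeasurableSet.inter ?_ (measurableSet_matchL _ _))
      (MeasurableSet.inter (MeasurableSet.inter (levelMeasurable_spineData _ _)
        (measurableSet_matchL _ _)) (ih _))
    exact (levelMeasurable_spineData _).measurableSet fun p => p.2 < p.1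

/-- Fubini: given the spine data, the free data match with a probability which is constant on the
set of compatible spines and zero elsewhere. -/
theorem sampleLaw_matches (p q : PMF ℕ) (d : List Block) :
    sampleLaw p q {x | Matches x 0 d} =
      listProd (fun n => (spineLaw (offspring p q n)).toMeasure) 0 (d.flatMap spineSets) *
        blocksWeight p q d := by
  rw [sampleLaw, Measure.prod_apply (measurableSet_matches 0 d)]
  set E : Set (ℕ → ℕ × ℕ) :=
    {y | ∀ i (hi : i < (d.flatMap spineSets).length), y i ∈ (d.flatMap spineSets)[i]}
  have hE : MeasurableSet E := by
    have : E = ⋂ i : Fin (d.flatMap spineSets).length,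
        (fun y => y i.1) ⁻¹' (d.flatMap spineSets)[i.1] := by
      ext y
      simp [E, Fin.forall_iff]
    rw [this]
    exact .iInter fun i => (measurable_pi_apply _) .of_discrete
  have hsec : ∀ y : ℕ → ℕ × ℕ,
      (Measure.infinitePi fun w : List ℕ => (offspring p q w.length).toMeasure)
        (Prod.mk y ⁻¹' {x | Matches x 0 d}) = E.indicator (fun _ => blocksWeight p q d) y := by
    intro y
    by_cases hy : y ∈ E
    · rw [Set.indicator_of_mem hy]
      have hset : Prod.mk y ⁻¹' {x | Matches x 0 d} =
          {z | ∀ c ∈ blockConstraints (y, fun _ => 0) 0 d, z c.1 = c.2} := by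
        -- The constrained words are located by the spine data only, so the section is a cylinder in
        -- the free data.
        have hb : ∀ (z : List ℕ → ℕ) (n : ℕ) (d : List Block),
            blockConstraints (y, z) n d = blockConstraints (y, fun _ => 0) n d := by
          intro z n d
          induction d generalizing n with
          | nil => rfl
          | cons b d ih => rw [blockConstraints, blockConstraints, ih]; rfl
        ext z
        simp only [Set.mem_preimage, Set.mem_ofPred_eq, matches_iff, hb z]
        refine ⟨fun h => h.2, fun h => ⟨?_, h⟩⟩
        simpa [E] using hy
      rw [hset, infinitePi_constraints _ (nodup_blockConstraints _ _ _)]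
      exact prod_blockConstraints p q (by simpa [E] using hy)
    · rw [Set.indicator_of_notMem hy]
      have hset : Prod.mk y ⁻¹' {x | Matches x 0 d} = ∅ := by
        ext z
        simp only [Set.mem_preimage, Set.mem_ofPred_eq, matches_iff, Set.mem_empty_iff_false,
          iff_false, not_and]
        intro h
        exact absurd (by simpa [E] using h) hy
      rw [hset, measure_empty]
  simp only [hsec]
  rw [lintegral_indicator_const hE, infinitePi_list, mul_comm]

end Kesten

-- Weights of words and of trees

/-- The factor `k` of the size-biasing cancels the `1 / k` of the uniform choice of the spine child.
-/
theorem spineLaw_apply {p : PMF ℕ} {m : ℝ≥0∞} (hm : ∑' k : ℕ, (k : ℝ≥0∞) * p k = m)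
    (h0 : m ≠ 0) (ht : m ≠ ∞) {k u : ℕ} (h : u < k) : spineLaw p (k, u) = p k * m⁻¹ := by
  have hk0 : (k : ℝ≥0∞) ≠ 0 := by exact_mod_cast (by omega : k ≠ 0)
  rw [spineLaw, PMF.bind_apply, tsum_eq_single k]
  · rw [sizeBiased, dif_pos ⟨hm.symm ▸ h0, hm.symm ▸ ht⟩, PMF.normalize_apply, hm]
    obtain ⟨n, rfl⟩ : ∃ n, k = n + 1 := ⟨k - 1, by omega⟩
    simp only
    rw [PMF.map_apply, tsum_eq_single u]
    · have hu : ((PMF.uniformOfFintype (Fin (n + 1))).bind fun a => PMF.pure (a : ℕ)) u =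
          ((n + 1 : ℕ) : ℝ≥0∞)⁻¹ := by
        rw [PMF.bind_apply, tsum_eq_single (⟨u, h⟩ : Fin (n + 1))]
        · simp
        · intro i hi
          rw [PMF.pure_apply, if_neg, mul_zero]
          exact fun he => hi (Fin.ext he.symm)
      rw [if_pos rfl]
      refine (congrArg _ hu).trans ?_
      calc _ = p (n + 1) * m⁻¹ * (((n + 1 : ℕ) : ℝ≥0∞) * ((n + 1 : ℕ) : ℝ≥0∞)⁻¹) := by ring
        _ = _ := by rw [ENNReal.mul_inv_cancel hk0 (ENNReal.natCast_ne_top _), mul_one]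
    · intro i hi
      rw [if_neg]
      intro he
      exact hi (Prod.ext_iff.1 he).2.symm
  · intro k' hk'
    cases k' with
    | zero =>
      simp only
      rw [PMF.pure_apply, if_neg (by simp; omega), mul_zero]
    | succ n =>
      simp only
      rw [PMF.map_apply, ENNReal.tsum_eq_zero.2, mul_zero]
      intro i
      rw [if_neg]
      intro he
      exact hk' (Prod.ext_iff.1 he).1.symm

namespace IsStepLaw

open CTree

variable {ν : Measure ℤ} [IsProbabilityMeasure ν]

theorem compl_ne_zero (h : IsStepLaw ν) : 1 - ν {1} ≠ 0 := fun h0 =>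
  h.one_ne_one (le_antisymm prob_le_one (tsub_eq_zero_iff_le.1 h0))

theorem compl_ne_top (ν : Measure ℤ) : 1 - ν {1} ≠ ∞ :=
  ne_top_of_le_ne_top ENNReal.one_ne_top tsub_le_self

theorem white_apply (h : IsStepLaw ν) (k : ℕ) : h.white k = ν {1} * (1 - ν {1}) ^ k := rfl

theorem black_apply (h : IsStepLaw ν) (k : ℕ) : h.black k = ν {-(k : ℤ)} / (1 - ν {1}) := rfl

theorem tsum_mul_white (h : IsStepLaw ν) :
    ∑' k : ℕ, (k : ℝ≥0∞) * h.white k = (1 - ν {1}) / ν {1} := by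
  set β : ℝ := (1 - ν {1}).toReal
  have hb : 1 - ν {1} = ENNReal.ofReal β := (ENNReal.ofReal_toReal (compl_ne_top ν)).symm
  have hβ0 : 0 ≤ β := ENNReal.toReal_nonneg
  have ha : ν {1} = ENNReal.ofReal (1 - β) := by
    rw [ENNReal.ofReal_sub _ hβ0, ← hb, ENNReal.ofReal_one,
      ENNReal.sub_sub_cancel ENNReal.one_ne_top prob_le_one]
  have hβ1 : 0 < 1 - β := by
    by_contra hle
    exact h.one_ne_zero (by rw [ha, ENNReal.ofReal_of_nonpos (not_lt.1 hle)])
  have hs := (hasSum_coe_mul_geometric_of_norm_lt_one (𝕜 := ℝ) (r := β)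
    (by rw [Real.norm_of_nonneg hβ0]; linarith)).mul_left (1 - β)
  have hterm : ∀ k : ℕ, (k : ℝ≥0∞) * h.white k = ENNReal.ofReal ((1 - β) * (k * β ^ k)) := by
    intro k
    rw [white_apply, hb, ha, ENNReal.ofReal_mul hβ1.le, ENNReal.ofReal_mul (Nat.cast_nonneg k),
      ENNReal.ofReal_natCast, ENNReal.ofReal_pow hβ0]
    ring
  simp only [hterm]
  rw [← ENNReal.ofReal_tsum_of_nonneg (fun k => by positivity) hs.summable, hs.tsum_eq, hb, ha,
    ← ENNReal.ofReal_div_of_pos hβ1]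
  congr 1
  field_simp

/-- By centering, the negative part has the same mean as the positive part, whose only nonzero value
is `1`. -/
theorem tsum_mul_neg (h : IsStepLaw ν) : ∑' k : ℕ, (k : ℝ≥0∞) * ν {-(k : ℤ)} = ν {1} := by
  have hpos : ∫⁻ k : ℤ, ENNReal.ofReal (k : ℝ) ∂ν = ν {1} := by
    rw [lintegral_countable', tsum_eq_single 1]
    · simp
    · intro k hk
      rcases lt_or_gt_of_ne hk with hk | hk
      · have : (k : ℝ) ≤ 0 := by exact_mod_cast (by omega : k ≤ 0)
        rw [ENNReal.ofReal_of_nonpos this, zero_mul]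
      · rw [measure_mono_null (Set.singleton_subset_iff.2 hk) h.skipFree, mul_zero]
  have hneg : ∫⁻ k : ℤ, ENNReal.ofReal (-(k : ℝ)) ∂ν = ∑' k : ℕ, (k : ℝ≥0∞) * ν {-(k : ℤ)} := by
    rw [lintegral_countable']
    have hinj : Function.Injective fun k : ℕ => -(k : ℤ) := fun a b hab => by simpa using hab
    rw [← hinj.tsum_eq]
    · simp
    · intro k hk
      by_contra hr
      refine hk ?_
      have hk0 : 0 < k := by
        by_contra hle
        exact hr ⟨(-k).toNat, by simp only; omega⟩
      have : -(k : ℝ) ≤ 0 := by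
        have : (0 : ℝ) < k := by exact_mod_cast hk0
        linarith
      simp only [ENNReal.ofReal_of_nonpos this, zero_mul]
  have hdiff := integral_eq_lintegral_pos_part_sub_lintegral_neg_part h.integrable
  rw [h.centered, hpos, hneg] at hdiff
  have htop : ∑' k : ℕ, (k : ℝ≥0∞) * ν {-(k : ℤ)} ≠ ∞ := by
    rw [← hneg]
    have hi := h.integrable.neg.lintegral_lt_top
    simpa using hi.ne
  exact ((ENNReal.toReal_eq_toReal_iff' htop (measure_ne_top _ _)).1 (by linarith))

theorem tsum_mul_black (h : IsStepLaw ν) :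
    ∑' k : ℕ, (k : ℝ≥0∞) * h.black k = ν {1} / (1 - ν {1}) := by
  simp only [black_apply, div_eq_mul_inv, ← mul_assoc]
  rw [ENNReal.tsum_mul_right, h.tsum_mul_neg]

/-- The probability of a sequence of steps. -/
noncomputable def wordWeight (ν : Measure ℤ) (w : List ℤ) : ℝ≥0∞ := (w.map fun k => ν {k}).prod

theorem wordWeight_append (ν : Measure ℤ) (u w : List ℤ) :
    wordWeight ν (u ++ w) = wordWeight ν u * wordWeight ν w := by
  simp [wordWeight]

/-- A white vertex with `k` children has weight `ν(1) (1 - ν(1))^k`: one up-step, and one factor for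
the denominator of each black child. In the white case the root is not counted in the forest, so the
factors of its children are supplied separately. -/
theorem forestWeight_eq (h : IsStepLaw ν) (t : CTree) :
    Kesten.forestWeight h.white h.black 1 t * (1 - ν {1}) ^ t.len = wordWeight ν t.whiteWord ∧
      Kesten.forestWeight h.white h.black 0 t = wordWeight ν t.blackWord := by
  induction t with
  | nil => simp [Kesten.forestWeight, len, wordWeight, whiteWord, blackWord]
  | cons x t ihx iht =>
    constructor
    · have h1 : wordWeight ν [-(x.len : ℤ)] = ν {-(x.len : ℤ)} := by simp [wordWeight]
      rw [whiteWord, wordWeight_append, wordWeight_append, h1, ← iht.1, ← ihx.2,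
        Kesten.forestWeight, Kesten.offspring_odd _ _ odd_one, Kesten.forestWeight_add_two, len,
        black_apply, pow_succ]
      have h2 : ν {-(x.len : ℤ)} / (1 - ν {1}) * (1 - ν {1}) = ν {-(x.len : ℤ)} :=
        ENNReal.div_mul_cancel h.compl_ne_zero (compl_ne_top ν)
      calc _ = Kesten.forestWeight h.white h.black 1 t * (1 - ν {1}) ^ t.len *
            (Kesten.forestWeight h.white h.black 0 x *
              (ν {-(x.len : ℤ)} / (1 - ν {1}) * (1 - ν {1}))) := by ring
        _ = _ := by rw [h2]
    · have h1 : wordWeight ν (1 :: x.whiteWord) = ν {1} * wordWeight ν x.whiteWord := by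
        simp [wordWeight]
      rw [blackWord, wordWeight_append, h1, ← iht.2, ← ihx.1, Kesten.forestWeight,
        Kesten.offspring_even _ _ Even.zero, white_apply]
      ring

/-- The number `u` of left children is discarded, hence summed over. Because the law is geometric,
each term is proportional to `h.white u`, and what remains is the original law at `r`. -/
theorem spineLaw_white (h : IsStepLaw ν) (r : ℕ) :
    (spineLaw h.white).toMeasure {p | p.2 < p.1 ∧ p.1 - 1 - p.2 = r} =
      ν {1} * (1 - ν {1}) ^ r := by
  have hset : {p : ℕ × ℕ | p.2 < p.1 ∧ p.1 - 1 - p.2 = r} = ⋃ u : ℕ, {(r + 1 + u, u)} := by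
    ext ⟨k, u⟩
    simp only [Set.mem_ofPred_eq, Set.mem_iUnion, Set.mem_singleton_iff, Prod.mk.injEq]
    constructor
    · rintro ⟨h1, h2⟩
      exact ⟨u, by omega, rfl⟩
    · rintro ⟨i, h1, rfl⟩
      omega
  have hm0 : (1 - ν {1}) / ν {1} ≠ 0 := ENNReal.div_ne_zero.2 ⟨h.compl_ne_zero, measure_ne_top _ _⟩
  have hmt : (1 - ν {1}) / ν {1} ≠ ∞ := ENNReal.div_ne_top (compl_ne_top ν) h.one_ne_zero
  rw [hset, measure_iUnion (fun i j hij => by simp [Function.onFun, hij])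
    (fun _ => measurableSet_singleton _)]
  have hterm : ∀ u : ℕ, (spineLaw h.white).toMeasure {(r + 1 + u, u)} =
      h.white u * ((1 - ν {1}) ^ (r + 1) * ((1 - ν {1}) / ν {1})⁻¹) := by
    intro u
    rw [PMF.toMeasure_apply_singleton _ _ (measurableSet_singleton _),
      spineLaw_apply h.tsum_mul_white hm0 hmt (by omega), white_apply, white_apply, pow_add]
    ring
  simp only [hterm]
  rw [ENNReal.tsum_mul_right, PMF.tsum_coe, one_mul, pow_succ,
    ENNReal.inv_div (Or.inl (measure_ne_top _ _)) (Or.inl h.one_ne_zero), mul_assoc,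
    ENNReal.mul_div_cancel h.compl_ne_zero (compl_ne_top ν), mul_comm]

theorem spineLaw_black (h : IsStepLaw ν) (a k : ℕ) :
    (spineLaw h.black).toMeasure {(a + k + 1, k)} = ν {-(a + (k + 1) : ℤ)} / ν {1} := by
  have hm0 : ν {1} / (1 - ν {1}) ≠ 0 := ENNReal.div_ne_zero.2 ⟨h.one_ne_zero, compl_ne_top ν⟩
  have hmt : ν {1} / (1 - ν {1}) ≠ ∞ := ENNReal.div_ne_top (measure_ne_top _ _) h.compl_ne_zero
  rw [PMF.toMeasure_apply_singleton _ _ (measurableSet_singleton _),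
    spineLaw_apply h.tsum_mul_black hm0 hmt (by omega), black_apply,
    ENNReal.inv_div (Or.inl (compl_ne_top ν)) (Or.inl h.compl_ne_zero), ← mul_div_assoc,
    ENNReal.div_mul_cancel h.compl_ne_zero (compl_ne_top ν)]
  congr 3

theorem listProd_spineSets (h : IsStepLaw ν) (n : ℕ) (d : List Block) :
    Kesten.listProd (fun n => (spineLaw (Kesten.offspring h.white h.black n)).toMeasure) (2 * n)
        (d.flatMap Kesten.spineSets) =
      (d.map fun b => ν {1} * (1 - ν {1}) ^ b.right.len *
        (ν {-(b.above.len + (b.k + 1) : ℤ)} / ν {1})).prod := by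
  induction d generalizing n with
  | nil => rfl
  | cons b d ih =>
    have hcons : (b :: d).flatMap Kesten.spineSets =
        {p | p.2 < p.1 ∧ p.1 - 1 - p.2 = b.right.len} ::
          {(b.above.len + b.k + 1, b.k)} :: d.flatMap Kesten.spineSets := rfl
    rw [hcons, Kesten.listProd, Kesten.listProd, show 2 * n + 1 + 1 = 2 * (n + 1) by ring, ih,
      Kesten.offspring_even _ _ (even_two_mul n), Kesten.offspring_odd _ _ (odd_two_mul_add_one n),
      h.spineLaw_white, h.spineLaw_black, List.map_cons, List.prod_cons, ← mul_assoc]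

theorem sampleLaw_matches (h : IsStepLaw ν) (d : List Block) :
    Kesten.sampleLaw h.white h.black {x | Kesten.Matches x 0 d} =
      wordWeight ν (d.flatMap Block.word) := by
  have h0 := h.listProd_spineSets 0 d
  rw [mul_zero] at h0
  rw [Kesten.sampleLaw_matches, h0, Kesten.blocksWeight, ← List.prod_map_mul]
  induction d with
  | nil => simp [wordWeight]
  | cons b d ih =>
    have h0' := h.listProd_spineSets 0 d
    rw [mul_zero] at h0'
    have hw : wordWeight ν b.word = ν {1} * (1 - ν {1}) ^ b.right.len *
        (ν {-(b.above.len + (b.k + 1) : ℤ)} / ν {1}) *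
        (Kesten.forestWeight h.white h.black 1 b.right *
          Kesten.forestWeight h.white h.black 0 b.above) := by
      -- The quotient by `ν(1)` comes from the mean of the black law. It is compensated by the
      -- factor `ν(1)` of the white spine vertex, which codes no step of the walk.
      have h1 : wordWeight ν [-(b.above.len + (b.k + 1) : ℤ)] =
          ν {-(b.above.len + (b.k + 1) : ℤ)} / ν {1} * ν {1} := by
        rw [ENNReal.div_mul_cancel h.one_ne_zero (measure_ne_top _ _)]
        simp [wordWeight]
      rw [Block.word, wordWeight_append, wordWeight_append, h1, ← (h.forestWeight_eq b.right).1,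
        ← (h.forestWeight_eq b.above).2]
      ring
    rw [List.map_cons, List.prod_cons, ih h0', List.flatMap_cons, wordWeight_append, hw]

end IsStepLaw

/-! ## Conclusion -/

namespace Coding

open Kesten

theorem levelMeasurable_extend (i : ℤ) : LevelMeasurable fun C : ℕ → ℤ => extend C i := by
  unfold extend
  split_ifs
  · exact .of_measurable (measurable_pi_apply _)
  · exact levelMeasurable_const _

theorem measurableSet_reads (s : ℤ) (w : List ℤ) :
    MeasurableSet {C : ℕ → ℤ | Reads C s w} := by
  induction w generalizing s with
  | nil => simp [Reads]
  | cons x w ih =>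
    refine MeasurableSet.inter ?_ (ih (s + 1))
    have : {C : ℕ → ℤ | extend C (s + 1) = extend C s + x} =
        ⋃ v : ℤ, {C | extend C s = v} ∩ {C | extend C (s + 1) = v + x} := by
      ext C; simp
    have hm : MeasurableSet {C : ℕ → ℤ | extend C (s + 1) = extend C s + x} := this ▸ .iUnion fun v =>
      (levelMeasurable_extend s v).inter (levelMeasurable_extend (s + 1) _)
    exact hm

theorem measurableSet_isGood : MeasurableSet {C : ℕ → ℤ | IsGood C} := by
  have : {C : ℕ → ℤ | IsGood C} = {C | C 0 = 0} ∩ ((⋂ n, {C | C (n + 1) ≤ C n + 1}) ∩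
      ⋂ n, ⋃ m, {C | n < m ∧ C m < C n}) := by
    ext C
    simp only [Set.mem_ofPred_eq, Set.mem_inter_iff, Set.mem_iInter, Set.mem_iUnion]
    exact ⟨fun h => ⟨h.1, h.2, h.3⟩, fun h => ⟨h.1, h.2.1, h.2.2⟩⟩
  rw [this]
  refine .inter ?_ (.inter (.iInter fun n => ?_)
    (.iInter fun n => .iUnion fun m => .inter (.const _) ?_))
  · exact (measurable_pi_apply 0) (measurableSet_singleton 0)
  · exact measurableSet_le (by fun_prop) (by fun_prop)
  · exact measurableSet_lt (f := fun C : ℕ → ℤ => C m) (g := fun C => C n)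
      (by fun_prop) (by fun_prop)

/-- The words which code the beginning of a tree whose ball of radius `R` has a given property. -/
def wordsOf (R : ℕ) (p : Set (List ℕ) → Prop) : Set (List ℤ) :=
  {w | ∃ d : List Block, d.length = R ∧ d.flatMap Block.word = w ∧
    p ((PlaneTree.unfold CTree.kids (Block.toTree d)).ball R)}

theorem ball_componentTree_iff {C : ℕ → ℤ} (h : IsGood C) (R : ℕ) (p : Set (List ℕ) → Prop) :
    p ((componentTree C).ball R) ↔ ∃ w ∈ wordsOf R p, Reads C 0 w := by
  constructor
  · intro hp
    obtain ⟨d, hd, hr⟩ := exists_blocks h R 0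
    exact ⟨_, ⟨d, hd, rfl, by rwa [← ball_componentTree h hr (by omega)]⟩, hr⟩
  · rintro ⟨_, ⟨d, hd, rfl, hp⟩, hr⟩
    rwa [ball_componentTree h hr (by omega)]

end Coding

namespace IsStepLaw

open Coding Walk

variable {ν : Measure ℤ} [IsProbabilityMeasure ν]

theorem ae_isGood (h : IsStepLaw ν) : ∀ᵐ C ∂walkLaw ν, IsGood C := by
  rw [walkLaw_eq, ae_map_iff measurable_partialSum.aemeasurable measurableSet_isGood]
  exact Walk.ae_isGood h

/-- Off the null set of bad paths the tree is replaced by a constant. On good paths a ball event is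
a union of cylinders indexed by words, which are countably many. -/
theorem aemeasurable_componentTree (h : IsStepLaw ν) :
    AEMeasurable componentTree (walkLaw ν) := by
  classical
  refine ⟨fun C => if IsGood C then componentTree C else PlaneTree.unfold CTree.kids .nil, ?_, ?_⟩
  · refine measurable_generateFrom ?_
    rintro _ ⟨s, R, rfl⟩
    have : (fun C => if IsGood C then componentTree C else PlaneTree.unfold CTree.kids .nil) ⁻¹'
        {t | t.ball R = s.ball R} =
        ({C | IsGood C} ∩ ⋃ w : wordsOf R fun b => b = s.ball R, {C | Reads C 0 w}) ∪
        ({C | IsGood C}ᶜ ∩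
          {_C | (PlaneTree.unfold CTree.kids .nil).ball R = s.ball R}) := by
      ext C
      by_cases hC : IsGood C
      · simp [hC, ball_componentTree_iff hC R fun b => b = s.ball R]
      · simp [hC]
    rw [this]
    exact (measurableSet_isGood.inter (.iUnion fun w => measurableSet_reads _ _)).union
      (measurableSet_isGood.compl.inter (.const _))
  · filter_upwards [h.ae_isGood] with C hC
    rw [if_pos hC]

/-- The words of `R` blocks cover almost every path, which bounds the left side by a sum. The
corresponding events `Matches` have the same probabilities and are disjoint, so the sum is the
probability of a union contained in the right-hand event. -/
theorem measure_ball_le (h : IsStepLaw ν) (R : ℕ) (p : Set (List ℕ) → Prop) :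
    walkLaw ν {C | p ((componentTree C).ball R)} ≤
      Kesten.sampleLaw h.white h.black
        {x | p (((Kesten.tree x).pruneLeft (Kesten.spine x)).ball R)} := by
  choose d hd1 hd2 hd3 using fun w : wordsOf R p => w.2
  calc walkLaw ν {C | p ((componentTree C).ball R)}
      ≤ walkLaw ν (⋃ w : wordsOf R p, {C | Reads C 0 w}) := by
        refine measure_mono_ae ?_
        filter_upwards [h.ae_isGood] with C hC hp
        obtain ⟨w, hw, hr⟩ := (ball_componentTree_iff hC R p).1 hp
        exact Set.mem_iUnion.2 ⟨⟨w, hw⟩, hr⟩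
    _ ≤ ∑' w : wordsOf R p, walkLaw ν {C | Reads C 0 w} := measure_iUnion_le _
    _ = ∑' w : wordsOf R p, Kesten.sampleLaw h.white h.black {x | Kesten.Matches x 0 (d w)} := by
        refine tsum_congr fun w => ?_
        rw [h.sampleLaw_matches, hd2, walkLaw_eq,
          Measure.map_apply measurable_partialSum (measurableSet_reads _ _)]
        exact measure_reads _
    _ = Kesten.sampleLaw h.white h.black (⋃ w, {x | Kesten.Matches x 0 (d w)}) := by
        refine (measure_iUnion (fun w w' hww' => ?_)
          fun w => Kesten.measurableSet_matches 0 (d w)).symm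
        refine Set.disjoint_left.2 fun x hx hx' => hww' (Subtype.ext ?_)
        rw [← hd2 w, ← hd2 w', Kesten.Matches.unique hx hx' ((hd1 w).trans (hd1 w').symm)]
    _ ≤ _ := by
        refine measure_mono (Set.iUnion_subset fun w x hx => ?_)
        have := hd3 w
        rwa [← Kesten.ball_pruneLeft hx (by rw [hd1]; omega)] at this

instance (p q : PMF ℕ) : IsProbabilityMeasure (kestenLeftLaw p q) := by
  have : IsProbabilityMeasure (Kesten.sampleLaw p q) := by
    unfold Kesten.sampleLaw
    infer_instance
  exact Measure.isProbabilityMeasure_map Kesten.measurable_pruneLeft.aemeasurable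

theorem map_componentTree (h : IsStepLaw ν) :
    (walkLaw ν).map componentTree = kestenLeftLaw h.white h.black := by
  have hw : IsProbabilityMeasure (walkLaw ν) := by
    rw [walkLaw_eq]
    exact Measure.isProbabilityMeasure_map measurable_partialSum.aemeasurable
  have hP : IsProbabilityMeasure ((walkLaw ν).map componentTree) :=
    Measure.isProbabilityMeasure_map h.aemeasurable_componentTree
  refine ext_of_generate_finite _ rfl ?_ ?_ (by simp)
  -- Two balls of the local topology with a common point `t` meet in the ball of `t` with the larger
  -- radius.
  · rintro _ ⟨s, R, rfl⟩ _ ⟨s', R', rfl⟩ ⟨t, ht, ht'⟩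
    have key : ∀ {u : PlaneTree} {n m : ℕ}, n ≤ m → u.ball m = t.ball m → u.ball n = t.ball n := by
      intro u n m hnm hu
      have hb : ∀ v : PlaneTree, v.ball n = {w ∈ v.ball m | w.length ≤ n} := by
        intro v
        ext w
        simp only [PlaneTree.ball, Set.mem_ofPred_eq]
        exact ⟨fun hw => ⟨⟨hw.1, hw.2.trans hnm⟩, hw.2⟩, fun hw => ⟨hw.1.1, hw.2⟩⟩
      rw [hb, hb t, hu]
    refine ⟨t, max R R', ?_⟩
    ext u
    simp only [Set.mem_inter_iff, Set.mem_ofPred_eq] at ht ht' ⊢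
    rw [← ht, ← ht']
    refine ⟨fun hu => ?_, fun hu => ⟨key (le_max_left _ _) hu, key (le_max_right _ _) hu⟩⟩
    rcases max_choice R R' with hm | hm
    · rw [hm]; exact hu.1
    · rw [hm]; exact hu.2
  · rintro _ ⟨s, R, rfl⟩
    have hA : MeasurableSet {t : PlaneTree | t.ball R = s.ball R} :=
      MeasurableSpace.measurableSet_generateFrom ⟨s, R, rfl⟩
    have hle : ∀ p : Set (List ℕ) → Prop, MeasurableSet {t : PlaneTree | p (t.ball R)} →
        (walkLaw ν).map componentTree {t | p (t.ball R)} ≤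
          kestenLeftLaw h.white h.black {t | p (t.ball R)} := by
      intro p hp
      rw [Measure.map_apply_of_aemeasurable h.aemeasurable_componentTree hp, kestenLeftLaw,
        Measure.map_apply Kesten.measurable_pruneLeft hp]
      exact h.measure_ball_le R p
    refine le_antisymm (hle (fun b => b = s.ball R) hA) ?_
    -- Both laws are probability measures, so the inequality for the complement is the reverse
    -- inequality for the event.
    have h2 := hle (fun b => ¬ b = s.ball R) hA.compl
    rw [show {t : PlaneTree | ¬ t.ball R = s.ball R} = {t : PlaneTree | t.ball R = s.ball R}ᶜ from rfl,
      prob_compl_eq_one_sub hA, prob_compl_eq_one_sub hA] at h2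
    exact (ENNReal.sub_le_sub_iff_left prob_le_one ENNReal.one_ne_top).1 h2

end IsStepLaw

/-- Let `C` be a random walk with law `P^ν_0`, where `ν` is a centered upwards-skip-free probability
measure on `ℤ` with `ν(0) = 0`. The tree of components of the infinite looptree coded by `C` has law
`GW^{(∞,l)}_{ν_∘,ν_•}`. -/
theorem mainTheorem3 (ν : Measure ℤ) [IsProbabilityMeasure ν] (hν : IsStepLaw ν)
    {Ω : Type*} [MeasurableSpace Ω] (P : Measure Ω) [IsProbabilityMeasure P]
    (C : Ω → ℕ → ℤ) (hC : HasLaw C (walkLaw ν) P) :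
    HasLaw (fun ω => Coding.componentTree (C ω)) (kestenLeftLaw hν.white hν.black) P :=
  HasLaw.fun_comp ⟨hν.aemeasurable_componentTree, hν.map_componentTree⟩ hC
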